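/- Let $k$ be an algebraically closed field of characteristic $0$, and let $H$ be a finite-dimensional Hopf algebra over $k$ with coproduct $\Delta(a)=a_1\otimes a_2$ (Sweedler notation) and counit $\varepsilon$. Suppose that 1. $H$ is pointed, i.e. every simple $H$-comodule is one-dimensional over $k$; and 2. $H$ is coquasitriangular, i.e. there is a linear form $\mathcal{R}\colon H\otimes H\to k$, invertible for the convolution product, such that for all $a,b,c\in H$ $$\mathcal{R}(ab,c)=\mathcal{R}(a,c_1)\,\mathcal{R}(b,c_2),\qquad \mathcal{R}(a,bc)=\mathcal{R}(a_1,c)\,\mathcal{R}(a_2,b),\qquad b_1a_1\,\mathcal{R}(a_2,b_2)=\mathcal{R}(a_1,b_1)\,a_2b_2 .$$ Then $H$ is generated as a $k$-algebra by its group-like elements (the $g\in H$ with $\Delta(g)=g\otimes g$ and $\varepsilon(g)=1$) together with its skew-primitive elements (the $x\in H$ with $\Delta(x)=x\otimes g+h\otimes x$ for some group-like elements $g,h\in H$). -/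

import Mathlib

open scoped TensorProduct

universe u v

/-- A right comodule structure on the `k`-vector space `V` over the `k`-coalgebra `C`. -/
structure RightComodule (k : Type u) (C : Type v) (V : Type v) [Field k]
    [AddCommGroup C] [Module k C] [Coalgebra k C] [AddCommGroup V] [Module k V] where
  /-- The coaction `ρ : V → V ⊗ C`. -/
  coact : V →ₗ[k] V ⊗[k] C
  /-- `(ρ ⊗ id) ρ = (id ⊗ Δ) ρ`, up to the associativity isomorphism. -/
  coassoc : ∀ x : V, TensorProduct.assoc k V C C (coact.rTensor C (coact x)) =
    (Coalgebra.comul (R := k) (A := C)).lTensor V (coact x)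
  /-- `(id ⊗ ε) ρ = id`, up to the isomorphism `V ⊗ k ≅ V`. -/
  counit_coact : ∀ x : V,
    TensorProduct.rid k V ((Coalgebra.counit (R := k) (A := C)).lTensor V (coact x)) = x

namespace RightComodule

variable {k : Type u} {C V : Type v} [Field k] [AddCommGroup C] [Module k C] [Coalgebra k C]
  [AddCommGroup V] [Module k V]

/-- `W` is a subcomodule: `ρ(W) ⊆ W ⊗ C`. -/
def IsSubcomodule (M : RightComodule k C V) (W : Submodule k V) : Prop :=
  ∀ x ∈ W, M.coact x ∈ LinearMap.range (W.subtype.rTensor C)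

/-- A comodule is simple if it is nonzero and its only subcomodules are `0` and itself. -/
def IsSimple (M : RightComodule k C V) : Prop :=
  Nontrivial V ∧ ∀ W : Submodule k V, M.IsSubcomodule W → W = ⊥ ∨ W = ⊤

end RightComodule

/-- A coalgebra is pointed if all its simple comodules are one-dimensional. (Every simple
`C`-comodule is isomorphic to a subcomodule of `C`, so it is no restriction to let the comodules
range over the universe of `C`.) -/
def IsPointedCoalgebra (k : Type u) (C : Type v) [Field k]
    [AddCommGroup C] [Module k C] [Coalgebra k C] : Prop :=
  ∀ (V : Type v) [AddCommGroup V] [Module k V] (M : RightComodule k C V),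
    M.IsSimple → Module.finrank k V = 1

/-- `x` is skew-primitive: `Δ(x) = x ⊗ g + h ⊗ x` for some group-like elements `g` and `h`. -/
def IsSkewPrimitiveElem (k : Type u) {C : Type v} [Field k]
    [AddCommGroup C] [Module k C] [Coalgebra k C] (x : C) : Prop :=
  ∃ g h : C, IsGroupLikeElem k g ∧ IsGroupLikeElem k h ∧
    Coalgebra.comul (R := k) x = x ⊗ₜ[k] g + h ⊗ₜ[k] x

/-- `r : H ⊗ H → k` is a universal `R`-form (a coquasitriangular structure) on `H`. -/
structure IsUniversalRForm {k : Type u} {H : Type v} [Field k] [Ring H] [HopfAlgebra k H]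
    (r : H ⊗[k] H →ₗ[k] k) : Prop where
  /-- `r` is invertible for the convolution product on linear forms on the coalgebra `H ⊗ H`. -/
  conv_invertible : IsUnit (WithConv.toConv r)
  /-- `r(ab, c) = r(a, c₁) r(b, c₂)`. -/
  mul_left : ∀ a b c : H, r ((a * b) ⊗ₜ[k] c) =
    LinearMap.mul' k k (TensorProduct.map (TensorProduct.curry r a) (TensorProduct.curry r b)
      (Coalgebra.comul (R := k) c))
  /-- `r(a, bc) = r(a₁, c) r(a₂, b)`. -/
  mul_right : ∀ a b c : H, r (a ⊗ₜ[k] (b * c)) =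
    LinearMap.mul' k k (TensorProduct.map ((TensorProduct.curry r).flip c)
      ((TensorProduct.curry r).flip b) (Coalgebra.comul (R := k) a))
  /-- `b₁ a₁ r(a₂, b₂) = r(a₁, b₁) a₂ b₂`, where `Δ(a ⊗ b) = (a₁ ⊗ b₁) ⊗ (a₂ ⊗ b₂)`. -/
  braided_comm : ∀ a b : H,
    TensorProduct.rid k H
      (TensorProduct.map (LinearMap.mul' k H ∘ₗ (TensorProduct.comm k H H).toLinearMap) r
        (Coalgebra.comul (R := k) (a ⊗ₜ[k] b))) =
    TensorProduct.lid k H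
      (TensorProduct.map r (LinearMap.mul' k H) (Coalgebra.comul (R := k) (a ⊗ₜ[k] b)))

/-! ### Linear forms acting on a coalgebra; the coradical filtration and frames adapted to it. -/

section CoalgebraActions

open Coalgebra

variable {k : Type u} {C : Type v} [Field k] [AddCommGroup C] [Module k C]

/-! Write F_n for `corFilt k H n`, so that F_0 = 0 and F_1 is spanned by the group-likes, and J for
`groupLikeAnnihilator k H`. Pointedness makes the filtration exhaustive, and it is multiplicative.
The proof works in the associated graded algebra, but stays inside H by means of congruences modulo
F_n. Classes of right degree 1 play the role of the coinvariants R, graded by group-likes through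
their left degree; V denotes the part of R in filtration degree one.

The R-form makes homogeneous classes commute up to scalars: yx ≡ r(a,b) xy for x, y in R of degrees
a, b (`smul_mul_sub_smul_mul_mem`). If z in R has degree g with r(g,g) = 1 and is detected by a form
vanishing on decomposables, that form acts as a derivation with ∂(z^(m+1)) ≡ (m+1) w(z) g z^m. In
characteristic 0 no power of z then drops in the filtration, contradicting finite dimension
(`apply_eq_zero_of_selfBraiding_eq_one`).

It follows that r(a,a) = -1 and r(a,b) r(b,a) = 1 for degrees a, b occurring in V. A nonzero class
of degree two in R has degree ab of this kind, hence self-braiding 1, so it cannot be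
indecomposable: R(2) = V·V (`mem_infinitesimalProducts`).

Higher degrees need no such analysis. The skew derivations ∂_s given by forms dual to V commute up
to scalars, because this can be tested in degree two (`actL_comm_mem`). Therefore the Euler operator
z ↦ ∑ ∂_s(z) a_s⁻¹ x_s multiplies degree n of R by n (`eulerOp_sub_mem`). Dividing by n writes z, up
to lower terms, through elements lower in the filtration and V, and V consists of skew-primitives
and group-likes. -/

lemma rid_lTensor_eq_sum {ι : Type*} [Fintype ι] {V : Type*} [AddCommGroup V] [Module k V]
    {b : ι → C} {β : ι → C →ₗ[k] k}
    (h : ∀ x, ∑ i, β i x • b i = x) (t : V ⊗[k] C) :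
    t = ∑ i, TensorProduct.rid k V ((β i).lTensor V t) ⊗ₜ[k] b i := by
  induction t with
  | zero => simp
  | tmul x y =>
    conv_lhs => rw [← h y]
    simp [TensorProduct.tmul_sum, TensorProduct.smul_tmul]
  | add x y hx hy =>
    conv_lhs => rw [hx, hy]
    simp [TensorProduct.add_tmul, Finset.sum_add_distrib]

lemma lid_rTensor_eq_sum {ι : Type*} [Fintype ι] {V : Type*} [AddCommGroup V] [Module k V]
    {b : ι → C} {β : ι → C →ₗ[k] k}
    (h : ∀ x, ∑ i, β i x • b i = x) (t : C ⊗[k] V) :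
    t = ∑ i, b i ⊗ₜ[k] TensorProduct.lid k V ((β i).rTensor V t) := by
  induction t with
  | zero => simp
  | tmul x y =>
    conv_lhs => rw [← h x]
    simp [TensorProduct.sum_tmul, TensorProduct.smul_tmul]
  | add x y hx hy =>
    conv_lhs => rw [hx, hy]
    simp [TensorProduct.tmul_add, Finset.sum_add_distrib]

lemma sum_apply_smul_eq {ι : Type*} [Fintype ι] {b : ι → C} {β : ι → C →ₗ[k] k}
    (h : ∀ x, ∑ i, β i x • b i = x) (f : C →ₗ[k] k) : ∑ i, f (b i) • β i = f := by
  ext x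
  conv_rhs => rw [← h x]
  simp [mul_comm]

variable [Coalgebra k C]

/-- The left action `x ↦ x₁ f(x₂)` of a linear form `f` on a coalgebra. -/
noncomputable def actL : (C →ₗ[k] k) →ₗ[k] C →ₗ[k] C where
  toFun f := (TensorProduct.rid k C).toLinearMap ∘ₗ f.lTensor C ∘ₗ comul
  map_add' f g := by ext; simp [LinearMap.lTensor_add]
  map_smul' a f := by ext; simp [LinearMap.lTensor_smul]

/-- The right action `x ↦ f(x₁) x₂` of a linear form `f` on a coalgebra. -/
noncomputable def actR : (C →ₗ[k] k) →ₗ[k] C →ₗ[k] C where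
  toFun f := (TensorProduct.lid k C).toLinearMap ∘ₗ f.rTensor C ∘ₗ comul
  map_add' f g := by ext; simp [LinearMap.rTensor_add]
  map_smul' a f := by ext; simp [LinearMap.rTensor_smul]

lemma actL_apply (f : C →ₗ[k] k) (x : C) :
    actL f x = TensorProduct.rid k C (f.lTensor C (comul x)) := rfl

lemma actR_apply (f : C →ₗ[k] k) (x : C) :
    actR f x = TensorProduct.lid k C (f.rTensor C (comul x)) := rfl

lemma comul_eq_sum_actL {ι : Type*} [Fintype ι] {b : ι → C} {β : ι → C →ₗ[k] k}
    (h : ∀ x, ∑ i, β i x • b i = x) (x : C) :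
    comul (R := k) x = ∑ i, actL (β i) x ⊗ₜ[k] b i :=
  rid_lTensor_eq_sum h _

lemma comul_eq_sum_actR {ι : Type*} [Fintype ι] {b : ι → C} {β : ι → C →ₗ[k] k}
    (h : ∀ x, ∑ i, β i x • b i = x) (x : C) :
    comul (R := k) x = ∑ i, b i ⊗ₜ[k] actR (β i) x :=
  lid_rTensor_eq_sum h _

lemma apply_actL (f g : C →ₗ[k] k) (x : C) : f (actL g x) = g (actR f x) := by
  simp only [actL_apply, actR_apply]
  induction comul (R := k) x with
  | zero => simp
  | tmul x y => simp [mul_comm]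
  | add x y hx hy => simp [hx, hy]

@[simp] lemma counit_actL (f : C →ₗ[k] k) (x : C) : counit (R := k) (actL f x) = f x := by
  rw [apply_actL, actR_apply]
  simp

@[simp] lemma counit_actR (f : C →ₗ[k] k) (x : C) : counit (R := k) (actR f x) = f x := by
  rw [← apply_actL, actL_apply]
  simp

@[simp] lemma actL_counit (x : C) : actL (counit (R := k)) x = x := by
  simp [actL_apply]

@[simp] lemma actR_counit (x : C) : actR (counit (R := k)) x = x := by
  simp [actR_apply]

/-- Linear forms on `C ⊗ C` of the form `f ⊗ g`. -/
lemma mul'_map_comul (f g : C →ₗ[k] k) (x : C) :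
    LinearMap.mul' k k (TensorProduct.map f g (comul x)) = f (actL g x) := by
  simp only [actL_apply]
  induction comul (R := k) x with
  | zero => simp
  | tmul x y => simp [mul_comm]
  | add x y hx hy => simp [hx, hy]

/-- Coassociativity: `f ∘ₗ actL g` is the convolution product of `f` and `g`, so `actL` is a left
action of the dual algebra. Likewise `actR` is a right action (`actR_actR`). -/
lemma actL_actL (f g : C →ₗ[k] k) (x : C) : actL f (actL g x) = actL (f ∘ₗ actL g) x := by
  have key : ∀ t : C ⊗[k] C,
      actL f (TensorProduct.rid k C (g.lTensor C t)) =
      TensorProduct.rid k C ((LinearMap.mul' k k ∘ₗ TensorProduct.map f g).lTensor C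
        (TensorProduct.assoc k C C C (comul.rTensor C t))) := by
    intro t
    induction t with
    | zero => simp
    | tmul x y =>
      simp only [LinearMap.lTensor_tmul, TensorProduct.rid_tmul, map_smul, actL_apply,
        LinearMap.rTensor_tmul]
      induction comul (R := k) x with
      | zero => simp
      | tmul x z => simp [smul_smul, mul_comm]
      | add x z hx hz => simp [TensorProduct.add_tmul, hx, hz]
    | add x y hx hy => simp [hx, hy]
  rw [actL_apply g, key, coassoc_apply, actL_apply, ← LinearMap.lTensor_comp_apply]
  congr 3
  ext y
  exact mul'_map_comul f g y

lemma actL_actR_comm (f g : C →ₗ[k] k) (x : C) : actL f (actR g x) = actR g (actL f x) := by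
  have h1 : ∀ t : C ⊗[k] C,
      actR g (TensorProduct.rid k C (f.lTensor C t)) =
      TensorProduct.lid k C (g.rTensor C ((TensorProduct.rid k C).toLinearMap.lTensor C
        ((f.lTensor C).lTensor C (TensorProduct.assoc k C C C (comul.rTensor C t))))) := by
    intro t
    induction t with
    | zero => simp
    | tmul x y =>
      simp only [LinearMap.lTensor_tmul, TensorProduct.rid_tmul, map_smul, actR_apply,
        LinearMap.rTensor_tmul]
      induction comul (R := k) x with
      | zero => simp
      | tmul x z => simp [smul_smul]
      | add x z hx hz => simp [TensorProduct.add_tmul, hx, hz]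
    | add x y hx hy => simp [hx, hy]
  have h2 : ∀ t : C ⊗[k] C,
      actL f (TensorProduct.lid k C (g.rTensor C t)) =
      TensorProduct.lid k C (g.rTensor C ((TensorProduct.rid k C).toLinearMap.lTensor C
        ((f.lTensor C).lTensor C (comul.lTensor C t)))) := by
    intro t
    induction t with
    | zero => simp
    | tmul x y => simp [actL_apply]
    | add x y hx hy => simp [hx, hy]
  rw [actR_apply g x, h2, actL_apply f x, h1, coassoc_apply]

lemma apply_actR (f g : C →ₗ[k] k) (x : C) : f (actR g x) = g (actL f x) :=
  (apply_actL g f x).symm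

lemma actR_actR (f g : C →ₗ[k] k) (x : C) : actR g (actR f x) = actR (f ∘ₗ actL g) x := by
  rw [← sub_eq_zero, ← Module.forall_dual_apply_eq_zero_iff k]
  intro φ
  rw [map_sub, sub_eq_zero, apply_actR, actL_actR_comm, ← apply_actL, apply_actR]
  rfl

@[simp] lemma actL_groupLike (f : C →ₗ[k] k) {g : C} (hg : IsGroupLikeElem k g) :
    actL f g = f g • g := by
  simp [actL_apply, hg]

@[simp] lemma actR_groupLike (f : C →ₗ[k] k) {g : C} (hg : IsGroupLikeElem k g) :
    actR f g = f g • g := by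
  simp [actR_apply, hg]


variable (k C) in
/-- The linear forms vanishing on all group-like elements. -/
def groupLikeAnnihilator : Submodule k (C →ₗ[k] k) where
  carrier := {f | ∀ g : C, IsGroupLikeElem k g → f g = 0}
  add_mem' hf hg x hx := by simp [hf x hx, hg x hx]
  zero_mem' := by simp
  smul_mem' a f hf x hx := by simp [hf x hx]

lemma comp_actL_mem_groupLikeAnnihilator {f : C →ₗ[k] k} (hf : f ∈ groupLikeAnnihilator k C)
    (e : C →ₗ[k] k) : f ∘ₗ actL e ∈ groupLikeAnnihilator k C := fun g hg => by
  simp [hg, hf g hg]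

variable (k C) in
/-- The filtration of a coalgebra by the powers of the annihilator of its group-like elements. If
`C` is pointed, then the term of index `n + 1` is the `n`-th term of the coradical filtration. -/
noncomputable def corFilt : ℕ → Submodule k C
  | 0 => ⊥
  | n + 1 => ⨅ f ∈ groupLikeAnnihilator k C, (corFilt n).comap (actL f)

@[simp] lemma corFilt_zero : corFilt k C 0 = ⊥ := rfl

lemma mem_corFilt_succ {n : ℕ} {x : C} :
    x ∈ corFilt k C (n + 1) ↔ ∀ f ∈ groupLikeAnnihilator k C, actL f x ∈ corFilt k C n := by
  simp [corFilt]

lemma actL_mem_corFilt (e : C →ₗ[k] k) {n : ℕ} {x : C} (hx : x ∈ corFilt k C n) :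
    actL e x ∈ corFilt k C n := by
  cases n with
  | zero => simp_all
  | succ n =>
    rw [mem_corFilt_succ] at hx ⊢
    intro f hf
    rw [actL_actL]
    exact hx _ (comp_actL_mem_groupLikeAnnihilator hf e)

lemma corFilt_le_succ (n : ℕ) : corFilt k C n ≤ corFilt k C (n + 1) := fun _ hx =>
  mem_corFilt_succ.2 fun _ _ => actL_mem_corFilt _ hx

lemma corFilt_mono : Monotone (corFilt k C) := monotone_nat_of_le_succ corFilt_le_succ

lemma actR_mem_corFilt (e : C →ₗ[k] k) {n : ℕ} {x : C} (hx : x ∈ corFilt k C n) :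
    actR e x ∈ corFilt k C n := by
  induction n generalizing x with
  | zero => simp_all
  | succ n ih =>
    rw [mem_corFilt_succ] at hx ⊢
    intro f hf
    rw [actL_actR_comm]
    exact ih (hx f hf)

lemma corFilt_one : corFilt k C 1 = Submodule.span k {g : C | IsGroupLikeElem k g} := by
  apply le_antisymm
  · intro x hx
    by_contra hn
    obtain ⟨f, hfx, hf⟩ := Submodule.exists_le_ker_of_notMem hn
    apply hfx
    rw [← counit_actL f x, (Submodule.mem_bot k).1 (mem_corFilt_succ.1 hx f fun g hg =>
      hf (Submodule.subset_span hg)), map_zero]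
  · rw [Submodule.span_le]
    intro g hg
    simp only [SetLike.mem_coe]
    rw [mem_corFilt_succ]
    intro f hf
    rw [actL_groupLike f hg, hf g hg, zero_smul]
    exact zero_mem _

lemma groupLike_mem_corFilt {g : C} (hg : IsGroupLikeElem k g) (n : ℕ) :
    g ∈ corFilt k C (n + 1) :=
  corFilt_mono (by omega : 1 ≤ n + 1) (by rw [corFilt_one]; exact Submodule.subset_span hg)

lemma actR_eq_zero_of_mem_corFilt_one {f : C →ₗ[k] k} (hf : f ∈ groupLikeAnnihilator k C)
    {x : C} (hx : x ∈ corFilt k C 1) : actR f x = 0 := by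
  rw [corFilt_one] at hx
  refine Submodule.span_induction (p := fun x _ => actR f x = 0) ?_ (by simp)
    (fun x y _ _ hx hy => by simp [hx, hy]) (fun a x _ hx => by simp [hx]) hx
  intro g hg
  rw [actR_groupLike f hg, hf g hg, zero_smul]

/-- The filtration is defined by the left action only; this restores the symmetry. The two actions
commute, and both kill F_1 under J because F_1 is spanned by group-likes. -/
lemma actR_mem_of_mem_corFilt_succ {f : C →ₗ[k] k} (hf : f ∈ groupLikeAnnihilator k C)
    {n : ℕ} {x : C} (hx : x ∈ corFilt k C (n + 1)) : actR f x ∈ corFilt k C n := by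
  induction n generalizing x with
  | zero =>
    rw [corFilt_zero, Submodule.mem_bot]
    exact actR_eq_zero_of_mem_corFilt_one hf hx
  | succ n ih =>
    rw [mem_corFilt_succ]
    intro e he
    rw [actL_actR_comm]
    exact ih (mem_corFilt_succ.1 hx e he)

variable (k C) in
/-- The linear forms vanishing on the `n`-th term of the filtration. -/
def corAnn (n : ℕ) : Submodule k (C →ₗ[k] k) where
  carrier := {f | ∀ x ∈ corFilt k C n, f x = 0}
  add_mem' hf hg x hx := by simp [hf x hx, hg x hx]
  zero_mem' := by simp
  smul_mem' a f hf x hx := by simp [hf x hx]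

lemma corAnn_anti {m n : ℕ} (h : m ≤ n) : corAnn k C n ≤ corAnn k C m := fun _ hf x hx =>
  hf x (corFilt_mono h hx)

lemma corAnn_one : corAnn k C 1 = groupLikeAnnihilator k C := by
  ext f
  constructor
  · exact fun hf g hg => hf g (groupLike_mem_corFilt hg 0)
  · intro hf x hx
    rw [corFilt_one] at hx
    exact Submodule.span_induction (p := fun x _ => f x = 0) (fun g hg => hf g hg) (by simp)
      (fun x y _ _ hx hy => by simp [hx, hy]) (fun a _ _ hx => by simp [hx]) hx

lemma mem_corFilt_of_forall {n : ℕ} {x : C} (h : ∀ f ∈ corAnn k C n, f x = 0) :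
    x ∈ corFilt k C n := by
  by_contra hn
  obtain ⟨f, hfx, hf⟩ := Submodule.exists_le_ker_of_notMem hn
  exact hfx (h f fun y hy => hf hy)

lemma exists_mem_corAnn_ne_zero {n : ℕ} {x : C} (hx : x ∉ corFilt k C n) :
    ∃ f ∈ corAnn k C n, f x ≠ 0 := by
  by_contra! h
  exact hx (mem_corFilt_of_forall h)

lemma actR_mem_corFilt_of_mem_corAnn {i n : ℕ} {f : C →ₗ[k] k} (hf : f ∈ corAnn k C i) {x : C}
    (hx : x ∈ corFilt k C (n + i)) : actR f x ∈ corFilt k C n := by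
  induction n generalizing x with
  | zero =>
    rw [Nat.zero_add] at hx
    refine mem_corFilt_of_forall fun e _ => ?_
    rw [apply_actR]
    exact hf _ (actL_mem_corFilt e hx)
  | succ n ih =>
    rw [mem_corFilt_succ]
    intro e he
    rw [actL_actR_comm]
    rw [Nat.add_right_comm] at hx
    exact ih (mem_corFilt_succ.1 hx e he)

/-- A factor of J is absorbed into the form: for `e` in J and `f` vanishing on F_i, the product `e
∘ₗ actL f` vanishes on F_(i+1). Hence the induction varies `i` along with `n`. -/
lemma actL_mem_corFilt_of_mem_corAnn {i n : ℕ} {f : C →ₗ[k] k} (hf : f ∈ corAnn k C i) {x : C}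
    (hx : x ∈ corFilt k C (n + i)) : actL f x ∈ corFilt k C n := by
  induction n generalizing f i with
  | zero =>
    rw [Nat.zero_add] at hx
    refine mem_corFilt_of_forall fun e _ => ?_
    rw [apply_actL]
    exact hf _ (actR_mem_corFilt e hx)
  | succ n ih =>
    rw [mem_corFilt_succ]
    intro e he
    rw [actL_actL]
    refine ih (i := i + 1) (fun y hy => ?_) (by rwa [Nat.add_right_comm] at hx)
    rw [LinearMap.comp_apply, apply_actL]
    exact hf _ (actR_mem_of_mem_corFilt_succ he hy)

lemma actL_mem_corFilt_sub {i n : ℕ} {f : C →ₗ[k] k} (hf : f ∈ corAnn k C i) {x : C}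
    (hx : x ∈ corFilt k C n) : actL f x ∈ corFilt k C (n - i) :=
  actL_mem_corFilt_of_mem_corAnn hf (corFilt_mono (by omega) hx)

/-- A decomposition of the identity compatible with the filtration. -/
structure IsFilteredFrame {ι : Type*} [Fintype ι] (b : ι → C) (β : ι → C →ₗ[k] k)
    (d : ι → ℕ) : Prop where
  sum_smul : ∀ x, ∑ i, β i x • b i = x
  mem_corFilt : ∀ i, b i ∈ corFilt k C (d i + 1)
  mem_corAnn : ∀ i, β i ∈ corAnn k C (d i)

/-- The general projection φ is there for the induction. With q' a projection onto F_n, the part q'φ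
is handled by induction, while φ - q'φ kills F_n and is expanded in a basis of F_(n+1) with degree
n. The result may be redundant; only the reconstruction formula is needed. -/
lemma exists_frame_of_range_le [FiniteDimensional k C] (n : ℕ) (φ : C →ₗ[k] C)
    (hφ : ∀ x, φ x ∈ corFilt k C n) (hfix : ∀ x ∈ corFilt k C n, φ x = x) :
    ∃ (ι : Type) (_ : Fintype ι) (b : ι → C) (β : ι → C →ₗ[k] k) (d : ι → ℕ),
      (∀ x, ∑ i, β i x • b i = φ x) ∧ (∀ i, b i ∈ corFilt k C (d i + 1)) ∧
      ∀ i, β i ∈ corAnn k C (d i) := by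
  induction n generalizing φ with
  | zero =>
    exact ⟨Empty, inferInstance, Empty.elim, Empty.elim, Empty.elim,
      fun x => by simpa using (hφ x).symm, by simp, by simp⟩
  | succ n ih =>
    obtain ⟨q, hq⟩ := LinearMap.exists_leftInverse_of_injective (corFilt k C n).subtype
      (Submodule.ker_subtype _)
    let q' : C →ₗ[k] C := (corFilt k C n).subtype ∘ₗ q
    have hq1 : ∀ x, q' x ∈ corFilt k C n := fun x => (q x).2
    have hq2 : ∀ x ∈ corFilt k C n, q' x = x := fun x hx =>
      congrArg Subtype.val (LinearMap.congr_fun hq ⟨x, hx⟩)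
    obtain ⟨ι, _, b, β, d, h1, h2, h3⟩ := ih (q' ∘ₗ φ) (fun x => hq1 _) fun x hx => by
      rw [LinearMap.comp_apply, hfix x (corFilt_le_succ n hx), hq2 x hx]
    let ψ : C →ₗ[k] corFilt k C (n + 1) := (φ - q' ∘ₗ φ).codRestrict _ fun x =>
      sub_mem (hφ x) (corFilt_le_succ n (hq1 _))
    let B := Module.finBasis k (corFilt k C (n + 1))
    refine ⟨ι ⊕ Fin _, inferInstance, Sum.elim b fun j => B j,
      Sum.elim β fun j => B.coord j ∘ₗ ψ, Sum.elim d fun _ => n, ?_, ?_, ?_⟩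
    · intro x
      have : ∑ j, (B.coord j (ψ x)) • (B j : C) = φ x - q' (φ x) := by
        have := congrArg (corFilt k C (n + 1)).subtype (B.sum_repr (ψ x))
        rw [map_sum] at this
        exact this
      rw [Fintype.sum_sum_type]
      simp only [Sum.elim_inl, Sum.elim_inr, LinearMap.comp_apply, h1, this]
      abel
    · rintro (i | j)
      · exact h2 i
      · exact (B j).2
    · rintro (i | j)
      · exact h3 i
      · intro x hx
        have : ψ x = 0 := by
          ext
          simp [ψ, hfix x (corFilt_le_succ n hx), hq2 x hx]
        simp [this]

lemma exists_isFilteredFrame [FiniteDimensional k C] {N : ℕ} (hN : corFilt k C N = ⊤) :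
    ∃ (ι : Type) (_ : Fintype ι) (b : ι → C) (β : ι → C →ₗ[k] k) (d : ι → ℕ),
      IsFilteredFrame b β d := by
  obtain ⟨ι, _, b, β, d, h1, h2, h3⟩ := exists_frame_of_range_le N LinearMap.id
    (fun x => hN ▸ Submodule.mem_top) (fun _ _ => rfl)
  exact ⟨ι, _, b, β, d, h1, h2, h3⟩

end CoalgebraActions

/-! ### Pointedness makes the filtration exhaustive. -/

section Pointed

open Coalgebra

variable {k : Type u} {C : Type v} [Field k] [AddCommGroup C] [Module k C] [Coalgebra k C]
  [FiniteDimensional k C] {V : Type v} [AddCommGroup V] [Module k V]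

/-- The right comodule associated with a left module over the convolution algebra of linear forms
on a finite-dimensional coalgebra. -/
noncomputable def RightComodule.ofAction (A : (C →ₗ[k] k) →ₗ[k] V →ₗ[k] V)
    (hone : ∀ v, A counit v = v) (hmul : ∀ f g v, A f (A g v) = A (f ∘ₗ actL g) v) :
    RightComodule k C V where
  coact := ∑ i, (TensorProduct.mk k V C).flip (Module.finBasis k C i) ∘ₗ
    A ((Module.finBasis k C).coord i)
  coassoc x := by
    have hB : ∀ x, ∑ i, (Module.finBasis k C).coord i x • Module.finBasis k C i = x :=
      (Module.finBasis k C).sum_repr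
    have hB' : ∀ f : C →ₗ[k] k,
        ∑ i, f (Module.finBasis k C i) • (Module.finBasis k C).coord i = f :=
      sum_apply_smul_eq hB
    have hc : ∀ x, comul (R := k) x = ∑ i, ∑ j,
        ((Module.finBasis k C).coord i ∘ₗ actL ((Module.finBasis k C).coord j)) x •
          (Module.finBasis k C i ⊗ₜ[k] Module.finBasis k C j) := fun x => by
      rw [comul_eq_sum_actL hB, Finset.sum_comm]
      refine Finset.sum_congr rfl fun j _ => ?_
      conv_lhs => rw [← hB (actL _ x), TensorProduct.sum_tmul]
      simp only [TensorProduct.smul_tmul', LinearMap.comp_apply]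
    simp only [LinearMap.sum_apply, map_sum, LinearMap.comp_apply, LinearMap.flip_apply,
      TensorProduct.mk_apply, LinearMap.rTensor_tmul, LinearMap.lTensor_tmul,
      TensorProduct.sum_tmul, TensorProduct.assoc_tmul, hmul]
    have : ∀ l, A ((Module.finBasis k C).coord l) x ⊗ₜ[k] comul (R := k) (Module.finBasis k C l) =
      ∑ i, ∑ j, A (((Module.finBasis k C).coord i ∘ₗ actL ((Module.finBasis k C).coord j))
        (Module.finBasis k C l) • (Module.finBasis k C).coord l) x ⊗ₜ[k]
          (Module.finBasis k C i ⊗ₜ[k] Module.finBasis k C j) := fun l => by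
      rw [hc]
      simp only [TensorProduct.tmul_sum, TensorProduct.tmul_smul, map_smul, LinearMap.smul_apply,
        TensorProduct.smul_tmul]
    simp only [this]
    rw [Finset.sum_comm]
    conv_rhs => rw [Finset.sum_comm]; enter [2, i]; rw [Finset.sum_comm]
    refine Finset.sum_congr rfl fun i _ => Finset.sum_congr rfl fun j _ => ?_
    rw [← TensorProduct.sum_tmul, ← LinearMap.sum_apply, ← map_sum, hB']
  counit_coact x := by
    have hB : ∀ x, ∑ i, (Module.finBasis k C).coord i x • Module.finBasis k C i = x :=
      (Module.finBasis k C).sum_repr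
    conv_rhs => rw [← hone x, ← sum_apply_smul_eq hB (counit (R := k))]
    simp only [LinearMap.sum_apply, map_sum, LinearMap.comp_apply, LinearMap.flip_apply,
      TensorProduct.mk_apply, LinearMap.lTensor_tmul, TensorProduct.rid_tmul, map_smul,
      LinearMap.smul_apply]

lemma RightComodule.ofAction_contract (A : (C →ₗ[k] k) →ₗ[k] V →ₗ[k] V)
    (hone : ∀ v, A counit v = v) (hmul : ∀ f g v, A f (A g v) = A (f ∘ₗ actL g) v)
    (f : C →ₗ[k] k) (v : V) :
    TensorProduct.rid k V (f.lTensor V ((RightComodule.ofAction A hone hmul).coact v)) = A f v := by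
  conv_rhs => rw [← sum_apply_smul_eq (β := (Module.finBasis k C).coord)
    (Module.finBasis k C).sum_repr f]
  simp only [RightComodule.ofAction, LinearMap.sum_apply, map_sum, LinearMap.comp_apply,
    LinearMap.flip_apply, TensorProduct.mk_apply, LinearMap.lTensor_tmul, TensorProduct.rid_tmul,
    map_smul, LinearMap.smul_apply]

lemma RightComodule.action_mem_of_isSubcomodule (A : (C →ₗ[k] k) →ₗ[k] V →ₗ[k] V)
    (hone : ∀ v, A counit v = v) (hmul : ∀ f g v, A f (A g v) = A (f ∘ₗ actL g) v)
    {W : Submodule k V} (hW : (RightComodule.ofAction A hone hmul).IsSubcomodule W)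
    (f : C →ₗ[k] k) {v : V} (hv : v ∈ W) : A f v ∈ W := by
  rw [← RightComodule.ofAction_contract A hone hmul]
  obtain ⟨t, ht⟩ := hW v hv
  rw [← ht]
  clear ht
  induction t with
  | zero => simp
  | tmul x y => simpa using W.smul_mem (f y) x.2
  | add x y hx hy =>
    simp only [map_add]
    exact W.add_mem hx hy

/-- A one-dimensional comodule is given by a group-like element. -/
lemma exists_isGroupLikeElem_of_finrank_eq_one (A : (C →ₗ[k] k) →ₗ[k] V →ₗ[k] V)
    (hone : ∀ v, A counit v = v) (hmul : ∀ f g v, A f (A g v) = A (f ∘ₗ actL g) v)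
    (hV : Module.finrank k V = 1) :
    ∃ c : C, IsGroupLikeElem k c ∧ ∀ f v, A f v = f c • v := by
  obtain ⟨v, hv0, hv⟩ := finrank_eq_one_iff'.1 hV
  choose χ hχ using fun f => hv (A f v)
  have hB : ∀ x, ∑ i, (Module.finBasis k C).coord i x • Module.finBasis k C i = x :=
    (Module.finBasis k C).sum_repr
  have key : ∀ f, A f v = f (∑ i, χ ((Module.finBasis k C).coord i) • Module.finBasis k C i) • v := by
    intro f
    conv_lhs => rw [← sum_apply_smul_eq hB f]
    simp only [map_sum, map_smul, LinearMap.sum_apply, LinearMap.smul_apply, ← hχ, smul_smul,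
      smul_eq_mul, Finset.sum_smul, mul_comm]
  set c := ∑ i, χ ((Module.finBasis k C).coord i) • Module.finBasis k C i
  have hinj : ∀ a b : k, a • v = b • v → a = b := fun _ _ h => smul_left_injective k hv0 h
  have hact : ∀ f : C →ₗ[k] k, actL f c = f c • c := by
    intro f
    rw [← sub_eq_zero, ← Module.forall_dual_apply_eq_zero_iff k]
    intro φ
    rw [map_sub, sub_eq_zero, map_smul, smul_eq_mul]
    apply hinj
    have := key (φ ∘ₗ actL f)
    rw [← hmul, key, map_smul, key, smul_smul] at this
    exact this.symm
  refine ⟨c, ⟨hinj _ _ ?_, ?_⟩, fun f w => ?_⟩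
  · rw [← key (counit (R := k)), hone, one_smul]
  · rw [comul_eq_sum_actL hB]
    simp only [hact, TensorProduct.smul_tmul]
    rw [← TensorProduct.tmul_sum, hB]
  · obtain ⟨a, rfl⟩ := hv w
    rw [map_smul, key, smul_comm]

/-- Take W minimal among the `actL`-stable subspaces strictly above F_n. Then W/F_n is a simple
comodule, hence a line on which forms act by evaluation at a group-like. Forms in J act by zero
there, so an element of W outside F_n lies in F_(n+1). -/
lemma corFilt_lt_succ (hC : IsPointedCoalgebra k C) {n : ℕ} (hn : corFilt k C n ≠ ⊤) :
    corFilt k C n < corFilt k C (n + 1) := by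
  let S : Set (Submodule k C) :=
    {W | corFilt k C n < W ∧ ∀ (f : C →ₗ[k] k), ∀ x ∈ W, actL f x ∈ W}
  obtain ⟨W, ⟨hnW, hst⟩, hmin⟩ := (wellFounded_lt (α := Submodule k C)).has_min S
    ⟨⊤, lt_top_iff_ne_top.2 hn, fun _ _ _ => trivial⟩
  let Q := (corFilt k C n).comap W.subtype
  let A : (C →ₗ[k] k) →ₗ[k] (W ⧸ Q) →ₗ[k] (W ⧸ Q) :=
    { toFun := fun f => Q.mapQ Q ((actL f).restrict (hst f)) fun x hx => actL_mem_corFilt f hx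
      map_add' := fun f g => by ext; simp; rfl
      map_smul' := fun a f => by ext; simp; rfl }
  have hA : ∀ f (x : W), A f (Q.mkQ x) = Q.mkQ ⟨actL f x, hst f x x.2⟩ := fun f x => rfl
  have hone : ∀ v, A counit v = v := by
    intro v
    obtain ⟨x, rfl⟩ := Q.mkQ_surjective v
    rw [hA]
    simp only [actL_counit]
  have hmul : ∀ f g v, A f (A g v) = A (f ∘ₗ actL g) v := by
    intro f g v
    obtain ⟨x, rfl⟩ := Q.mkQ_surjective v
    simp only [hA, actL_actL]
  obtain ⟨x₀, hx₀W, hx₀⟩ := Set.exists_of_ssubset hnW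
  have hsimple : (RightComodule.ofAction A hone hmul).IsSimple := by
    refine ⟨⟨Q.mkQ ⟨x₀, hx₀W⟩, 0, fun h => hx₀ ?_⟩, fun U hU => or_iff_not_imp_left.2 fun hbot => ?_⟩
    · simpa [Q] using h
    · have hU' : ∀ f v, v ∈ U → A f v ∈ U := fun f v hv =>
        RightComodule.action_mem_of_isSubcomodule A hone hmul hU f hv
      obtain ⟨v, hvU, hv0⟩ := U.ne_bot_iff.1 hbot
      obtain ⟨y, rfl⟩ := Q.mkQ_surjective v
      have hmem : (U.comap Q.mkQ).map W.subtype ∈ S := by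
        refine ⟨lt_of_le_of_ne ?_ ?_, ?_⟩
        · intro z hz
          refine ⟨⟨z, hnW.le hz⟩, ?_, rfl⟩
          have : Q.mkQ ⟨z, hnW.le hz⟩ = 0 := by simpa [Q] using hz
          simp only [SetLike.mem_coe, Submodule.mem_comap, this, zero_mem]
        · intro heq
          have : (y : C) ∈ corFilt k C n := by
            rw [heq]
            exact ⟨y, hvU, rfl⟩
          exact hv0 (by simpa [Q] using this)
        · rintro f _ ⟨z, hz, rfl⟩
          exact ⟨⟨actL f z, hst f z z.2⟩, hU' f _ hz, rfl⟩
      have hle : W ≤ (U.comap Q.mkQ).map W.subtype := by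
        by_contra hle
        exact hmin _ hmem (lt_of_le_of_ne (Submodule.map_subtype_le _ _) fun h => hle h.ge)
      rw [eq_top_iff]
      rintro v -
      obtain ⟨z, rfl⟩ := Q.mkQ_surjective v
      obtain ⟨z', hz', hzz⟩ := hle z.2
      rwa [← Subtype.ext hzz]
  obtain ⟨c, hc, hAc⟩ := exists_isGroupLikeElem_of_finrank_eq_one A hone hmul
    (hC (W ⧸ Q) _ hsimple)
  refine lt_of_le_of_ne (corFilt_le_succ n) fun heq => hx₀ ?_
  rw [heq]
  refine mem_corFilt_succ.2 fun f hf => ?_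
  have := hAc f (Q.mkQ ⟨x₀, hx₀W⟩)
  rw [hf c hc, zero_smul, hA] at this
  simpa [Q] using this

lemma exists_corFilt_eq_top (hC : IsPointedCoalgebra k C) : ∃ N, corFilt k C N = ⊤ := by
  by_contra! h
  have : ∀ n, n ≤ Module.finrank k (corFilt k C n) := by
    intro n
    induction n with
    | zero => simp
    | succ n ih =>
      have := Submodule.finrank_lt_finrank_of_lt (corFilt_lt_succ hC (h n))
      omega
  have h1 := this (Module.finrank k C + 1)
  have h2 := Submodule.finrank_le (corFilt k C (Module.finrank k C + 1))
  omega

end Pointed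

/-! ### Idempotents dual to the group-likes, and homogeneous elements. -/

section DualIdempotents

open Coalgebra

variable {k : Type u} {C : Type v} [Field k] [AddCommGroup C] [Module k C] [Coalgebra k C]

instance [FiniteDimensional k C] : Finite (GroupLike k C) :=
  (linearIndep_groupLikeVal (R := k) (A := C)).finite

/-- A complete family of orthogonal idempotents of the convolution algebra of linear forms which
is dual to the family of group-like elements. -/
structure IsDualIdempotents [Fintype (GroupLike k C)] [DecidableEq (GroupLike k C)]
    (e : GroupLike k C → C →ₗ[k] k) : Prop where
  apply_val : ∀ g h : GroupLike k C, e g h.val = if g = h then 1 else 0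
  comp_actL : ∀ g h, e g ∘ₗ actL (e h) = if g = h then e g else 0
  sum_eq : ∑ g, e g = counit

lemma isNilpotent_of_mem_groupLikeAnnihilator {N : ℕ} (hN : corFilt k C N = ⊤)
    {f : WithConv (C →ₗ[k] k)} (hf : f.ofConv ∈ groupLikeAnnihilator k C) : IsNilpotent f := by
  have key : ∀ n m x, x ∈ corFilt k C (n + m) → actL (f ^ m).ofConv x ∈ corFilt k C n := by
    intro n m
    induction m with
    | zero =>
      intro x hx
      exact actL_mem_corFilt _ hx
    | succ m ih =>
      intro x hx
      have : (f ^ (m + 1)).ofConv = (f ^ m).ofConv ∘ₗ actL f.ofConv := by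
        ext y
        rw [pow_succ]
        exact mul'_map_comul _ _ _
      rw [this, ← actL_actL]
      exact ih _ (mem_corFilt_succ.1 hx _ hf)
  refine ⟨N, ?_⟩
  ext x
  have := key 0 N x (by rw [Nat.zero_add, hN]; trivial)
  rw [corFilt_zero, Submodule.mem_bot] at this
  rw [← counit_actL, this]
  simp

/-- Evaluation at the group-likes is a surjection from the dual algebra onto a product of copies of
k, by linear independence of group-likes. Its kernel J is nil, so the standard idempotents lift. -/
lemma exists_isDualIdempotents [Fintype (GroupLike k C)] [DecidableEq (GroupLike k C)]
    (hex : ∃ N, corFilt k C N = ⊤) :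
    ∃ e : GroupLike k C → C →ₗ[k] k, IsDualIdempotents e := by
  obtain ⟨N, hN⟩ := hex
  let φ : WithConv (C →ₗ[k] k) →+* (GroupLike k C → k) :=
    { toFun := fun f g => f.ofConv g.val
      map_one' := by ext g; simp [LinearMap.convOne_def]
      map_mul' := fun f f' => by ext g; simp
      map_zero' := by ext g; simp
      map_add' := fun f f' => by ext g; simp }
  have hφ : ∀ f g, φ f g = f.ofConv g.val := fun _ _ => rfl
  have hsurj : ∀ v, v ∈ φ.range := by
    intro v
    have hli := linearIndep_groupLikeVal (R := k) (A := C)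
    obtain ⟨F, hF⟩ := LinearMap.exists_extend ((Module.Basis.span hli).constr k v)
    refine ⟨WithConv.toConv F, ?_⟩
    ext g
    have := LinearMap.congr_fun hF (Module.Basis.span hli g)
    rw [Module.Basis.constr_basis] at this
    rw [hφ, ← this, LinearMap.comp_apply, Submodule.subtype_apply, Module.Basis.span_apply]
  obtain ⟨e, he, hφe⟩ := CompleteOrthogonalIdempotents.lift_of_isNilpotent_ker φ
    (fun f hf => isNilpotent_of_mem_groupLikeAnnihilator hN fun g hg =>
      congrFun hf (⟨g, hg⟩ : GroupLike k C))
    (CompleteOrthogonalIdempotents.single fun _ : GroupLike k C => k) (fun _ => hsurj _)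
  refine ⟨fun g => (e g).ofConv, fun g h => ?_, fun g h => ?_, ?_⟩
  · rw [← hφ, ← Function.comp_apply (f := φ), hφe]
    simp only [Pi.single_apply, eq_comm]
  · have : (e g).ofConv ∘ₗ actL (e h).ofConv = (e g * e h).ofConv := by
      ext y
      exact (mul'_map_comul _ _ _).symm
    rw [this, he.toOrthogonalIdempotents.mul_eq]
    split_ifs <;> simp
  · have := congrArg WithConv.ofConv he.complete
    exact (map_sum (WithConv.addEquiv (C →ₗ[k] k)) _ _).symm.trans (this.trans (by ext; simp))

variable [Fintype (GroupLike k C)] [DecidableEq (GroupLike k C)] {e : GroupLike k C → C →ₗ[k] k}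

lemma IsDualIdempotents.sum_actL (he : IsDualIdempotents e) (x : C) : ∑ g, actL (e g) x = x := by
  rw [← LinearMap.sum_apply, ← map_sum, he.sum_eq, actL_counit]

lemma IsDualIdempotents.sum_actR (he : IsDualIdempotents e) (x : C) : ∑ g, actR (e g) x = x := by
  rw [← LinearMap.sum_apply, ← map_sum, he.sum_eq, actR_counit]

/-- `z` is a homogeneous element of right degree `h` modulo the `n`-th term of the filtration. -/
structure IsRightHomogeneous (n : ℕ) (h : GroupLike k C) (z : C) : Prop where
  mem : z ∈ corFilt k C (n + 1)
  actL_sub : ∀ f : C →ₗ[k] k, actL f z - f h.val • z ∈ corFilt k C n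

/-- `z` is a homogeneous element of left degree `g` modulo the `n`-th term of the filtration. -/
structure IsLeftHomogeneous (n : ℕ) (g : GroupLike k C) (z : C) : Prop where
  mem : z ∈ corFilt k C (n + 1)
  actR_sub : ∀ f : C →ₗ[k] k, actR f z - f g.val • z ∈ corFilt k C n

omit [Fintype (GroupLike k C)] [DecidableEq (GroupLike k C)] in
lemma isRightHomogeneous_val (g : GroupLike k C) : IsRightHomogeneous 0 g g.val :=
  ⟨groupLike_mem_corFilt g.2 0, fun f => by simp⟩

omit [Fintype (GroupLike k C)] [DecidableEq (GroupLike k C)] in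
lemma isLeftHomogeneous_val (g : GroupLike k C) : IsLeftHomogeneous 0 g g.val :=
  ⟨groupLike_mem_corFilt g.2 0, fun f => by simp⟩

/-- The form f * e_h - f(h) e_h vanishes at every group-like, so it lies in J and lowers the
filtration by one. -/
lemma IsDualIdempotents.isRightHomogeneous (he : IsDualIdempotents e) (h : GroupLike k C) {n : ℕ}
    {x : C} (hx : x ∈ corFilt k C (n + 1)) : IsRightHomogeneous n h (actL (e h) x) := by
  refine ⟨actL_mem_corFilt _ hx, fun f => ?_⟩
  rw [actL_actL, ← LinearMap.smul_apply, ← map_smul, ← LinearMap.sub_apply, ← map_sub]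
  refine mem_corFilt_succ.1 hx _ fun g hg => ?_
  have := he.apply_val h ⟨g, hg⟩
  simp only [LinearMap.sub_apply, LinearMap.comp_apply, actL_groupLike _ hg, LinearMap.smul_apply,
    map_smul, smul_eq_mul, this]
  split_ifs with h1
  · simp [h1]
  · simp

lemma IsDualIdempotents.isLeftHomogeneous (he : IsDualIdempotents e) (h : GroupLike k C) {n : ℕ}
    {x : C} (hx : x ∈ corFilt k C (n + 1)) : IsLeftHomogeneous n h (actR (e h) x) := by
  refine ⟨actR_mem_corFilt _ hx, fun f => ?_⟩
  rw [actR_actR, ← LinearMap.smul_apply, ← map_smul, ← LinearMap.sub_apply, ← map_sub]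
  refine actR_mem_of_mem_corFilt_succ (fun g hg => ?_) hx
  have := he.apply_val h ⟨g, hg⟩
  simp only [LinearMap.sub_apply, LinearMap.comp_apply, actL_groupLike _ hg, LinearMap.smul_apply,
    map_smul, smul_eq_mul, this]
  split_ifs with h1
  · simp [h1]
  · simp

omit [Fintype (GroupLike k C)] [DecidableEq (GroupLike k C)]

lemma IsRightHomogeneous.actR {i n : ℕ} {h : GroupLike k C} {z : C}
    (hz : IsRightHomogeneous (n + i) h z) {f : C →ₗ[k] k} (hf : f ∈ corAnn k C i) :
    IsRightHomogeneous n h (actR f z) := by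
  refine ⟨actR_mem_corFilt_of_mem_corAnn hf (by simpa [Nat.add_right_comm] using hz.mem),
    fun φ => ?_⟩
  rw [actL_actR_comm, ← map_smul, ← map_sub]
  exact actR_mem_corFilt_of_mem_corAnn hf (hz.actL_sub φ)

lemma IsLeftHomogeneous.actL {i n : ℕ} {h : GroupLike k C} {z : C}
    (hz : IsLeftHomogeneous (n + i) h z) {f : C →ₗ[k] k} (hf : f ∈ corAnn k C i) :
    IsLeftHomogeneous n h (actL f z) := by
  refine ⟨actL_mem_corFilt_of_mem_corAnn hf (by simpa [Nat.add_right_comm] using hz.mem),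
    fun φ => ?_⟩
  rw [← actL_actR_comm, ← map_smul, ← map_sub]
  exact actL_mem_corFilt_of_mem_corAnn hf (hz.actR_sub φ)

lemma mem_corAnn_zero (f : C →ₗ[k] k) : f ∈ corAnn k C 0 := fun x hx => by
  rw [(Submodule.mem_bot k).1 hx, map_zero]

/-- The top component of a left homogeneous element is a multiple of its degree. -/
lemma actL_eq_of_isLeftHomogeneous {n : ℕ} {g : GroupLike k C} {z : C}
    (hz : IsLeftHomogeneous n g z) {f : C →ₗ[k] k} (hf : f ∈ corAnn k C n) :
    actL f z = f z • g.val := by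
  have h1 : IsLeftHomogeneous 0 g (actL f z) := IsLeftHomogeneous.actL (by simpa using hz) hf
  rw [← sub_eq_zero, ← Module.forall_dual_apply_eq_zero_iff k]
  intro φ
  have := h1.actR_sub φ
  rw [corFilt_zero, Submodule.mem_bot] at this
  have := congrArg (counit (R := k)) this
  rw [map_sub, counit_actR, map_smul, counit_actL, map_zero] at this
  rw [map_sub, ← this, map_smul]
  simp [mul_comm]

end DualIdempotents

/-! ### Multiplicativity of the filtration and top-degree forms as derivations. -/

section Multiplication

open Coalgebra

variable {k : Type u} {H : Type v} [Field k] [Ring H] [Bialgebra k H]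

lemma actL_mul {ι : Type*} [Fintype ι] {b : ι → H} {β : ι → H →ₗ[k] k}
    (h : ∀ x, ∑ i, β i x • b i = x) (f : H →ₗ[k] k) (x y : H) :
    actL f (x * y) = ∑ i, actL (β i) x * actL (f ∘ₗ LinearMap.mulLeft k (b i)) y := by
  have key : ∀ (u v : H) (t : H ⊗[k] H),
      TensorProduct.rid k H (f.lTensor H (u ⊗ₜ[k] v * t)) =
      u * TensorProduct.rid k H ((f ∘ₗ LinearMap.mulLeft k v).lTensor H t) := by
    intro u v t
    induction t with
    | zero => simp
    | tmul x y => simp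
    | add x y hx hy => simp only [mul_add, map_add, hx, hy]
  rw [actL_apply, Bialgebra.comul_mul, comul_eq_sum_actL h x, Finset.sum_mul, map_sum, map_sum]
  exact Finset.sum_congr rfl fun i _ => key _ _ _

lemma actR_mul {ι : Type*} [Fintype ι] {b : ι → H} {β : ι → H →ₗ[k] k}
    (h : ∀ x, ∑ i, β i x • b i = x) (f : H →ₗ[k] k) (x y : H) :
    actR f (x * y) = ∑ i, actR (β i) x * actR (f ∘ₗ LinearMap.mulLeft k (b i)) y := by
  have key : ∀ (u v : H) (t : H ⊗[k] H),
      TensorProduct.lid k H (f.rTensor H (v ⊗ₜ[k] u * t)) =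
      u * TensorProduct.lid k H ((f ∘ₗ LinearMap.mulLeft k v).rTensor H t) := by
    intro u v t
    induction t with
    | zero => simp
    | tmul x y => simp
    | add x y hx hy => simp only [mul_add, map_add, hx, hy]
  rw [actR_apply, Bialgebra.comul_mul, comul_eq_sum_actR h x, Finset.sum_mul, map_sum, map_sum]
  exact Finset.sum_congr rfl fun i _ => key _ _ _

lemma actL_mul_groupLike (f : H →ₗ[k] k) (g : GroupLike k H) (x : H) :
    actL f (x * g.val) = actL (f ∘ₗ LinearMap.mulRight k g.val) x * g.val := by
  have key : ∀ t : H ⊗[k] H, TensorProduct.rid k H (f.lTensor H (t * g.val ⊗ₜ[k] g.val)) =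
      TensorProduct.rid k H ((f ∘ₗ LinearMap.mulRight k g.val).lTensor H t) * g.val := by
    intro t
    induction t with
    | zero => simp
    | tmul x y => simp
    | add x y hx hy => simp only [add_mul, map_add, hx, hy]
  rw [actL_apply, Bialgebra.comul_mul, g.2.comul_eq_tmul_self, key, actL_apply]

lemma comp_mulLeft_mem_groupLikeAnnihilator {f : H →ₗ[k] k} (hf : f ∈ groupLikeAnnihilator k H)
    {x : H} (hx : x ∈ corFilt k H 1) :
    f ∘ₗ LinearMap.mulLeft k x ∈ groupLikeAnnihilator k H := by
  intro g hg
  rw [corFilt_one] at hx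
  refine Submodule.span_induction (p := fun x _ => (f ∘ₗ LinearMap.mulLeft k x) g = 0) ?_ (by simp)
    (fun x y _ _ hx hy => by simp_all [add_mul]) (fun a x _ hx => by simp_all) hx
  exact fun h hh => hf _ (hh.mul hg)

variable [FiniteDimensional k H]

/-- Induction on m + n. Expand the action of f in J on xy along a frame. If b_i has degree 0 it is a
combination of group-likes, f(b_i ·) stays in J and lowers y; otherwise β_i is in J and lowers x. -/
lemma mul_mem_corFilt (hex : ∃ N, corFilt k H N = ⊤) {m n : ℕ} {x y : H}
    (hx : x ∈ corFilt k H m) (hy : y ∈ corFilt k H (n + 1)) : x * y ∈ corFilt k H (m + n) := by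
  obtain ⟨N, hN⟩ := hex
  obtain ⟨ι, _, b, β, d, hfr⟩ := exists_isFilteredFrame hN
  induction hs : m + n generalizing m n x y with
  | zero =>
    obtain rfl : m = 0 := by omega
    simp_all
  | succ s ih =>
    cases m with
    | zero => simp_all
    | succ m =>
      rw [mem_corFilt_succ]
      intro f hf
      rw [actL_mul hfr.sum_smul]
      refine Submodule.sum_mem _ fun i _ => ?_
      rcases Nat.eq_zero_or_pos (d i) with hd | hd
      · have h1 : actL (f ∘ₗ LinearMap.mulLeft k (b i)) y ∈ corFilt k H n :=
          mem_corFilt_succ.1 hy _ (comp_mulLeft_mem_groupLikeAnnihilator hf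
            (by simpa [hd] using hfr.mem_corFilt i))
        cases n with
        | zero => simp_all
        | succ n => exact ih (actL_mem_corFilt _ hx) h1 (by omega)
      · refine ih (m := m) (n := n) (mem_corFilt_succ.1 hx _ ?_) (actL_mem_corFilt _ hy) (by omega)
        rw [← corAnn_one]
        exact corAnn_anti hd (hfr.mem_corAnn i)

lemma mul_mem_corFilt' (hex : ∃ N, corFilt k H N = ⊤) {m n : ℕ} {x y : H}
    (hx : x ∈ corFilt k H (m + 1)) (hy : y ∈ corFilt k H n) : x * y ∈ corFilt k H (m + n) := by
  cases n with
  | zero => simp_all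
  | succ n =>
    have := mul_mem_corFilt hex hx hy
    rwa [Nat.add_right_comm] at this

lemma mul_sub_mem_corFilt (hex : ∃ N, corFilt k H N = ⊤) {m n : ℕ} {x y u v : H} {a c : k}
    (hx : x ∈ corFilt k H (m + 1)) (hu : u - a • x ∈ corFilt k H m) (hv : v ∈ corFilt k H (n + 1))
    (hv' : v - c • y ∈ corFilt k H n) : u * v - (a * c) • (x * y) ∈ corFilt k H (m + n) := by
  have : u * v - (a * c) • (x * y) = (u - a • x) * v + a • (x * (v - c • y)) := by
    simp only [sub_mul, mul_sub, smul_sub, smul_mul_assoc, mul_smul_comm, smul_smul]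
    abel
  rw [this]
  exact add_mem (mul_mem_corFilt hex hu hv)
    (Submodule.smul_mem _ _ (mul_mem_corFilt' hex hx hv'))

lemma IsRightHomogeneous.mul (hex : ∃ N, corFilt k H N = ⊤) {m n : ℕ} {g h : GroupLike k H}
    {x y : H} (hx : IsRightHomogeneous m g x) (hy : IsRightHomogeneous n h y) :
    IsRightHomogeneous (m + n) (g * h) (x * y) := by
  refine ⟨by simpa [Nat.add_assoc] using mul_mem_corFilt' hex hx.mem hy.mem, fun f => ?_⟩
  obtain ⟨N, hN⟩ := id hex
  obtain ⟨ι, _, b, β, d, hfr⟩ := exists_isFilteredFrame hN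
  have : f (g * h).val = ∑ i, β i g.val * (f ∘ₗ LinearMap.mulLeft k (b i)) h.val := by
    rw [GroupLike.val_mul]
    conv_lhs => rw [← hfr.sum_smul g.val]
    simp [Finset.sum_mul]
  rw [actL_mul hfr.sum_smul, this, Finset.sum_smul, ← Finset.sum_sub_distrib]
  exact Submodule.sum_mem _ fun i _ => mul_sub_mem_corFilt hex hx.mem (hx.actL_sub _)
    (actL_mem_corFilt _ hy.mem) (hy.actL_sub _)

lemma IsLeftHomogeneous.mul (hex : ∃ N, corFilt k H N = ⊤) {m n : ℕ} {g h : GroupLike k H}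
    {x y : H} (hx : IsLeftHomogeneous m g x) (hy : IsLeftHomogeneous n h y) :
    IsLeftHomogeneous (m + n) (g * h) (x * y) := by
  refine ⟨by simpa [Nat.add_assoc] using mul_mem_corFilt' hex hx.mem hy.mem, fun f => ?_⟩
  obtain ⟨N, hN⟩ := id hex
  obtain ⟨ι, _, b, β, d, hfr⟩ := exists_isFilteredFrame hN
  have : f (g * h).val = ∑ i, β i g.val * (f ∘ₗ LinearMap.mulLeft k (b i)) h.val := by
    rw [GroupLike.val_mul]
    conv_lhs => rw [← hfr.sum_smul g.val]
    simp [Finset.sum_mul]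
  rw [actR_mul hfr.sum_smul, this, Finset.sum_smul, ← Finset.sum_sub_distrib]
  exact Submodule.sum_mem _ fun i _ => mul_sub_mem_corFilt hex hx.mem (hx.actR_sub _)
    (actR_mem_corFilt _ hy.mem) (hy.actR_sub _)

lemma groupLike_mul_mem_corFilt (hex : ∃ N, corFilt k H N = ⊤) (g : GroupLike k H) {n : ℕ} {x : H}
    (hx : x ∈ corFilt k H n) : g.val * x ∈ corFilt k H n := by
  simpa using mul_mem_corFilt' hex (groupLike_mem_corFilt g.2 0) hx

lemma mul_groupLike_mem_corFilt (hex : ∃ N, corFilt k H N = ⊤) (g : GroupLike k H) {n : ℕ} {x : H}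
    (hx : x ∈ corFilt k H n) : x * g.val ∈ corFilt k H n := by
  simpa using mul_mem_corFilt hex hx (groupLike_mem_corFilt g.2 0)

/-- Top-degree linear forms vanishing on decomposable elements act as derivations. -/
lemma actL_mul_sub_mem_corFilt (hex : ∃ N, corFilt k H N = ⊤) {n p q : ℕ} (hn : 1 ≤ n)
    {w : H →ₗ[k] k} (hw : w ∈ corAnn k H n)
    (hdec : ∀ i j, 1 ≤ i → 1 ≤ j → i + j = n → ∀ x ∈ corFilt k H (i + 1),
      ∀ y ∈ corFilt k H (j + 1), w (x * y) = 0)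
    {x y : H} (hx : IsRightHomogeneous p (1 : GroupLike k H) x) (hy : IsRightHomogeneous (q + n) (1 : GroupLike k H) y) :
    actL w (x * y) - (actL w x * y + x * actL w y) ∈ corFilt k H (p + q) := by
  obtain ⟨N, hN⟩ := id hex
  obtain ⟨ι, _, b, β, d, hfr⟩ := exists_isFilteredFrame hN
  have h1 : x * actL w y =
      ∑ i, β i (1 : H) • (x * actL (w ∘ₗ LinearMap.mulLeft k (b i)) y) := by
    have : w = ∑ i, β i (1 : H) • w ∘ₗ LinearMap.mulLeft k (b i) := by
      ext z
      have := hfr.sum_smul 1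
      conv_lhs => rw [← one_mul z, ← this]
      simp [Finset.sum_mul]
    conv_lhs => rw [this]
    simp [Finset.mul_sum]
  have h2 : actL w x * y = ∑ i, w (b i) • (actL (β i) x * y) := by
    conv_lhs => rw [← sum_apply_smul_eq hfr.sum_smul w]
    simp [Finset.sum_mul]
  rw [h1, h2, actL_mul hfr.sum_smul, ← Finset.sum_add_distrib, ← Finset.sum_sub_distrib]
  refine Submodule.sum_mem _ fun i _ => ?_
  have hone : 1 ≤ d i → β i (1 : H) = 0 := fun h =>
    hfr.mem_corAnn i _ (corFilt_mono h (groupLike_mem_corFilt IsGroupLikeElem.one 0))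
  have hwb : d i < n → w (b i) = 0 := fun h => hw _ (corFilt_mono (by omega) (hfr.mem_corFilt i))
  have hβx : actL (β i) x ∈ corFilt k H (p + 1 - d i) :=
    actL_mem_corFilt_sub (hfr.mem_corAnn i) hx.mem
  rcases Nat.eq_zero_or_pos (d i) with hd | hd
  -- Degree 0: replacing β_i by its value at 1 costs one filtration step on x, and these terms
  -- assemble to `x * actL w y`.
  · rw [hwb (by omega), zero_smul, zero_add, ← smul_mul_assoc, ← sub_mul]
    refine mul_mem_corFilt hex (hx.actL_sub (β i)) ?_
    refine actL_mem_corFilt_of_mem_corAnn (i := n) (fun z hz => ?_)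
      (by simpa [Nat.add_right_comm] using hy.mem)
    have hb := hfr.mem_corFilt i
    rw [hd] at hb
    have := mul_mem_corFilt' hex hb hz
    rw [Nat.zero_add] at this
    exact hw _ this
  rw [hone hd, zero_smul, add_zero]
  rcases lt_trichotomy (d i) n with hdn | hdn | hdn
  -- Strictly between 0 and n: w kills decomposables, so w(b_i ·) vanishes on F_(n-d+1), one step
  -- more than degree counting gives.
  · rw [hwb hdn, zero_smul, sub_zero]
    have h3 : actL (w ∘ₗ LinearMap.mulLeft k (b i)) y ∈ corFilt k H (q + d i) := by
      refine actL_mem_corFilt_of_mem_corAnn (i := n - d i + 1) (fun z hz => ?_)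
        (corFilt_mono (by omega) hy.mem)
      exact hdec (d i) (n - d i) hd (by omega) (by omega) _ (hfr.mem_corFilt i) _ hz
    rcases lt_or_ge p (d i) with hp | hp
    · rw [Nat.sub_eq_zero_of_le hp, corFilt_zero, Submodule.mem_bot] at hβx
      simp [hβx]
    · rw [show p + 1 - d i = (p - d i) + 1 by omega] at hβx
      have := mul_mem_corFilt' hex hβx h3
      rwa [show p - d i + (q + d i) = p + q by omega] at this
  -- Degree n: the form w(b_i ·) acts on y by w(b_i) to leading order, which yields `actL w x * y`.
  · rw [← mul_smul_comm, ← mul_sub]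
    have h3 := hy.actL_sub (w ∘ₗ LinearMap.mulLeft k (b i))
    rw [LinearMap.comp_apply, LinearMap.mulLeft_apply, GroupLike.val_one, mul_one] at h3
    rcases lt_or_ge p (d i) with hp | hp
    · rw [Nat.sub_eq_zero_of_le hp, corFilt_zero, Submodule.mem_bot] at hβx
      simp [hβx]
    · rw [show p + 1 - d i = (p - d i) + 1 by omega] at hβx
      have := mul_mem_corFilt' hex hβx h3
      rwa [show p - d i + (q + n) = p + q by omega] at this
  -- Degree above n: `actL (β i) x` is already too low in the filtration to contribute.
  · have h4 : ∀ z ∈ corFilt k H (q + n + 1), actL (β i) x * z ∈ corFilt k H (p + q) := by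
      intro z hz
      rcases lt_or_ge p (d i) with hp | hp
      · rw [Nat.sub_eq_zero_of_le hp, corFilt_zero, Submodule.mem_bot] at hβx
        simp [hβx]
      · exact corFilt_mono (by omega) (mul_mem_corFilt hex hβx hz)
    exact sub_mem (h4 _ (actL_mem_corFilt _ hy.mem)) (Submodule.smul_mem _ _ (h4 _ hy.mem))

end Multiplication

/-! ### Commutation relations from the R-form. -/

section RForm

open Coalgebra

variable {k : Type u} {H : Type v} [Field k] [Ring H] [HopfAlgebra k H] {r : H ⊗[k] H →ₗ[k] k}

namespace IsUniversalRForm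

lemma apply_ne_zero (hr : IsUniversalRForm r) (g h : GroupLike k H) :
    r (g.val ⊗ₜ[k] h.val) ≠ 0 := by
  obtain ⟨s, hs⟩ := hr.conv_invertible.exists_right_inv
  intro h0
  have := congrArg (fun f => f.ofConv (g.val ⊗ₜ[k] h.val)) hs
  simp [LinearMap.convOne_def, LinearMap.convMul_def, TensorProduct.comul_tmul, h0] at this

lemma apply_mul_left (hr : IsUniversalRForm r) (g h l : GroupLike k H) :
    r ((g * h).val ⊗ₜ[k] l.val) = r (g.val ⊗ₜ[k] l.val) * r (h.val ⊗ₜ[k] l.val) := by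
  rw [GroupLike.val_mul, hr.mul_left]
  simp

lemma apply_mul_right (hr : IsUniversalRForm r) (g h l : GroupLike k H) :
    r (g.val ⊗ₜ[k] (h * l).val) = r (g.val ⊗ₜ[k] l.val) * r (g.val ⊗ₜ[k] h.val) := by
  rw [GroupLike.val_mul, hr.mul_right]
  simp

lemma apply_one_right (hr : IsUniversalRForm r) (g : GroupLike k H) :
    r (g.val ⊗ₜ[k] (1 : GroupLike k H).val) = 1 := by
  have := hr.apply_mul_right g 1 1
  rw [mul_one] at this
  exact (mul_right_cancel₀ (hr.apply_ne_zero g 1) (by rw [one_mul]; exact this)).symm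

lemma apply_one_left (hr : IsUniversalRForm r) (g : GroupLike k H) :
    r ((1 : GroupLike k H).val ⊗ₜ[k] g.val) = 1 := by
  have := hr.apply_mul_left 1 1 g
  rw [mul_one] at this
  exact (mul_right_cancel₀ (hr.apply_ne_zero 1 g) (by rw [one_mul]; exact this)).symm

lemma apply_inv_left (hr : IsUniversalRForm r) (g h : GroupLike k H) :
    r (g⁻¹.val ⊗ₜ[k] h.val) * r (g.val ⊗ₜ[k] h.val) = 1 := by
  rw [← hr.apply_mul_left, inv_mul_cancel, hr.apply_one_left]

variable [FiniteDimensional k H]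

/-- Homogeneous elements commute up to a scalar and terms of lower degree. -/
lemma smul_mul_sub_smul_mul_mem (hr : IsUniversalRForm r) (hex : ∃ N, corFilt k H N = ⊤) {m n : ℕ}
    {g g' h h' : GroupLike k H} {x y : H} (hx : IsLeftHomogeneous m g x)
    (hx' : IsRightHomogeneous m g' x) (hy : IsLeftHomogeneous n h y)
    (hy' : IsRightHomogeneous n h' y) :
    r (g'.val ⊗ₜ[k] h'.val) • (y * x) - r (g.val ⊗ₜ[k] h.val) • (x * y) ∈ corFilt k H (m + n) := by
  obtain ⟨N, hN⟩ := id hex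
  obtain ⟨ι, _, b, β, d, hfr⟩ := exists_isFilteredFrame hN
  have hexp : ∀ a c : H, r (a ⊗ₜ[k] c) = ∑ i, ∑ j, r (b i ⊗ₜ[k] b j) * (β i a * β j c) := by
    intro a c
    conv_lhs => rw [← hfr.sum_smul a, ← hfr.sum_smul c]
    simp only [TensorProduct.sum_tmul, TensorProduct.tmul_sum, map_sum, ← TensorProduct.smul_tmul',
      TensorProduct.tmul_smul, map_smul, smul_eq_mul]
    simp only [Finset.mul_sum]
    rw [Finset.sum_comm]
    exact Finset.sum_congr rfl fun i _ => Finset.sum_congr rfl fun j _ => by ring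
  have hl : TensorProduct.rid k H
        (TensorProduct.map (LinearMap.mul' k H ∘ₗ (TensorProduct.comm k H H).toLinearMap) r
        (comul (R := k) (x ⊗ₜ[k] y))) =
      ∑ i, ∑ j, r (b i ⊗ₜ[k] b j) • (actL (β j) y * actL (β i) x) := by
    rw [TensorProduct.comul_tmul, comul_eq_sum_actL hfr.sum_smul x,
      comul_eq_sum_actL hfr.sum_smul y]
    simp only [TensorProduct.sum_tmul, TensorProduct.tmul_sum, map_sum]
    rw [Finset.sum_comm]
    simp
  have hr' : TensorProduct.lid k H
        (TensorProduct.map r (LinearMap.mul' k H) (comul (R := k) (x ⊗ₜ[k] y))) =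
      ∑ i, ∑ j, r (b i ⊗ₜ[k] b j) • (actR (β i) x * actR (β j) y) := by
    rw [TensorProduct.comul_tmul, comul_eq_sum_actR hfr.sum_smul x,
      comul_eq_sum_actR hfr.sum_smul y]
    simp only [TensorProduct.sum_tmul, TensorProduct.tmul_sum, map_sum]
    rw [Finset.sum_comm]
    simp
  have hb := hr.braided_comm x y
  rw [hl, hr'] at hb
  -- Each factor acts on a homogeneous element by a scalar to leading order, and the scalars add up
  -- to the value of r on the degrees.
  have h1 : ∑ i, ∑ j, r (b i ⊗ₜ[k] b j) • (actL (β j) y * actL (β i) x) -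
      r (g'.val ⊗ₜ[k] h'.val) • (y * x) ∈ corFilt k H (m + n) := by
    simp only [hexp g'.val, Finset.sum_smul, ← Finset.sum_sub_distrib, mul_smul, ← smul_sub]
    refine Submodule.sum_mem _ fun i _ => Submodule.sum_mem _ fun j _ => Submodule.smul_mem _ _ ?_
    rw [smul_smul, mul_comm, add_comm m]
    exact mul_sub_mem_corFilt hex hy'.mem (hy'.actL_sub _) (actL_mem_corFilt _ hx'.mem)
      (hx'.actL_sub _)
  have h2 : ∑ i, ∑ j, r (b i ⊗ₜ[k] b j) • (actR (β i) x * actR (β j) y) -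
      r (g.val ⊗ₜ[k] h.val) • (x * y) ∈ corFilt k H (m + n) := by
    simp only [hexp g.val, Finset.sum_smul, ← Finset.sum_sub_distrib, mul_smul, ← smul_sub]
    refine Submodule.sum_mem _ fun i _ => Submodule.sum_mem _ fun j _ => Submodule.smul_mem _ _ ?_
    rw [smul_smul]
    exact mul_sub_mem_corFilt hex hx.mem (hx.actR_sub _) (actR_mem_corFilt _ hy.mem)
      (hy.actR_sub _)
  rw [hb] at h1
  have := sub_mem h2 h1
  rwa [sub_sub_sub_cancel_left] at this

/-- This is the filtration-degree-0 case, where the error term lies in F_0 = 0. -/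
lemma groupLike_mul_comm (hr : IsUniversalRForm r) (hex : ∃ N, corFilt k H N = ⊤)
    (g h : GroupLike k H) : g * h = h * g := by
  have := hr.smul_mul_sub_smul_mul_mem hex (isLeftHomogeneous_val g) (isRightHomogeneous_val g)
    (isLeftHomogeneous_val h) (isRightHomogeneous_val h)
  rw [corFilt_zero, Submodule.mem_bot, ← smul_sub, smul_eq_zero, sub_eq_zero] at this
  exact GroupLike.val_injective (this.resolve_left (hr.apply_ne_zero g h)).symm

/-- Moving a group-like element past a homogeneous element of right degree `1`. -/
lemma mul_groupLike_sub_mem (hr : IsUniversalRForm r) (hex : ∃ N, corFilt k H N = ⊤) {n : ℕ}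
    (g : GroupLike k H) {a : GroupLike k H} {x : H} (hx : IsLeftHomogeneous n a x)
    (hx' : IsRightHomogeneous n (1 : GroupLike k H) x) :
    x * g.val - r (g.val ⊗ₜ[k] a.val) • (g.val * x) ∈ corFilt k H n := by
  have := hr.smul_mul_sub_smul_mul_mem hex (isLeftHomogeneous_val g) (isRightHomogeneous_val g)
    hx hx'
  rwa [hr.apply_one_right, one_smul, Nat.zero_add] at this

section Powers

variable [CharZero k]

/-- Let `z` be a homogeneous element with trivial self-braiding. A linear form of top degree which
vanishes on decomposable elements is a derivation with constant value on `z`. Since the powers of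
`z` lie in a finite-dimensional space, this value is zero. -/
lemma apply_eq_zero_of_selfBraiding_eq_one (hr : IsUniversalRForm r)
    (hex : ∃ N, corFilt k H N = ⊤) {n : ℕ} (hn : 1 ≤ n) {g : GroupLike k H} {z : H}
    (hz : IsLeftHomogeneous n g z) (hz' : IsRightHomogeneous n (1 : GroupLike k H) z)
    (hg : r (g.val ⊗ₜ[k] g.val) = 1) {w : H →ₗ[k] k} (hw : w ∈ corAnn k H n)
    (hdec : ∀ i j, 1 ≤ i → 1 ≤ j → i + j = n → ∀ x ∈ corFilt k H (i + 1),
      ∀ y ∈ corFilt k H (j + 1), w (x * y) = 0) : w z = 0 := by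
  by_contra hwz
  have hpow : ∀ m, IsRightHomogeneous (n * m) (1 : GroupLike k H) (z ^ m) := by
    intro m
    induction m with
    | zero => simpa using isRightHomogeneous_val (1 : GroupLike k H)
    | succ m ih =>
      have := ih.mul hex hz'
      rwa [mul_one, ← pow_succ, ← Nat.mul_succ] at this
  have hcomm : z * g.val - g.val * z ∈ corFilt k H n := by
    have := hr.mul_groupLike_sub_mem hex g hz hz'
    rwa [hg, one_smul] at this
  have hcomm_pow : ∀ m, z ^ m * g.val - g.val * z ^ m ∈ corFilt k H (n * m) := by
    intro m
    induction m with
    | zero => simp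
    | succ m ih =>
      have h1 := mul_mem_corFilt' hex (hpow m).mem hcomm
      have h2 := mul_mem_corFilt hex ih hz.mem
      have := add_mem h1 h2
      rw [← Nat.mul_succ] at this
      convert this using 1
      rw [pow_succ, mul_sub, sub_mul]
      simp only [mul_assoc]
      abel
  -- Derivation rule plus commutation of z^m with g; the starting value is `actL w z = w z • g`.
  have hder : ∀ m, actL w (z ^ (m + 1)) - ((m + 1 : k) * w z) • (g.val * z ^ m) ∈
      corFilt k H (n * m) := by
    intro m
    induction m with
    | zero => simp [actL_eq_of_isLeftHomogeneous hz hw]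
    | succ m ih =>
      have h1 := actL_mul_sub_mem_corFilt (q := 0) hex hn hw hdec (hpow (m + 1))
        (by simpa using hz')
      rw [Nat.add_zero, ← pow_succ, actL_eq_of_isLeftHomogeneous hz hw] at h1
      have h2 := mul_mem_corFilt hex ih hz.mem
      rw [← Nat.mul_succ] at h2
      have := add_mem (add_mem h1 h2) (Submodule.smul_mem _ (w z) (hcomm_pow (m + 1)))
      convert this using 1
      rw [sub_mul, smul_mul_assoc, mul_assoc g.val, ← pow_succ, mul_smul_comm]
      push_cast
      module
  -- If z^(m+1) dropped, then so would g z^m, its coefficient (m+1) w(z) being nonzero; cancelling g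
  -- reaches z^m.
  have hnot : ∀ m, z ^ m ∉ corFilt k H (n * m) := by
    intro m
    induction m with
    | zero =>
      intro h
      have h1 : (1 : H) = 0 := by simpa using h
      exact (IsGroupLikeElem.one (R := k) (A := H)).ne_zero h1
    | succ m ih =>
      intro h
      have h1 : actL w (z ^ (m + 1)) ∈ corFilt k H (n * m) :=
        actL_mem_corFilt_of_mem_corAnn hw (by rwa [← Nat.mul_succ])
      have h2 := sub_mem h1 (hder m)
      rw [sub_sub_cancel] at h2
      have h3 : g.val * z ^ m ∈ corFilt k H (n * m) :=
        (Submodule.smul_mem_iff _ (mul_ne_zero (Nat.cast_add_one_ne_zero m) hwz)).1 h2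
      have h4 := groupLike_mul_mem_corFilt hex g⁻¹ h3
      rw [← mul_assoc, ← GroupLike.val_mul, inv_mul_cancel, GroupLike.val_one, one_mul] at h4
      exact ih h4
  obtain ⟨N, hN⟩ := hex
  exact hnot N (corFilt_mono (Nat.le_mul_of_pos_left N hn) (hN ▸ Submodule.mem_top))

end Powers

end IsUniversalRForm

end RForm

/-! ### Degrees one and two: self-braidings and the absence of new generators. -/

section LowDegree

open Coalgebra

variable {k : Type u} {H : Type v} [Field k] [Ring H] [HopfAlgebra k H] {r : H ⊗[k] H →ₗ[k] k}
  [FiniteDimensional k H]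

lemma groupLike_mul_mem_corFilt_iff (hex : ∃ N, corFilt k H N = ⊤) (g : GroupLike k H) {n : ℕ}
    {x : H} : g.val * x ∈ corFilt k H n ↔ x ∈ corFilt k H n := by
  refine ⟨fun h => ?_, groupLike_mul_mem_corFilt hex g⟩
  have := groupLike_mul_mem_corFilt hex g⁻¹ h
  rwa [← mul_assoc, ← GroupLike.val_mul, inv_mul_cancel, GroupLike.val_one, one_mul] at this

lemma mul_groupLike_mem_corFilt_iff (hex : ∃ N, corFilt k H N = ⊤) (g : GroupLike k H) {n : ℕ}
    {x : H} : x * g.val ∈ corFilt k H n ↔ x ∈ corFilt k H n := by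
  refine ⟨fun h => ?_, mul_groupLike_mem_corFilt hex g⟩
  have := mul_groupLike_mem_corFilt hex g⁻¹ h
  rwa [mul_assoc, ← GroupLike.val_mul, mul_inv_cancel, GroupLike.val_one, mul_one] at this

lemma IsRightHomogeneous.mul_val (hex : ∃ N, corFilt k H N = ⊤) {n : ℕ} {g : GroupLike k H}
    {x : H} (hx : IsRightHomogeneous n g x) (h : GroupLike k H) :
    IsRightHomogeneous n (g * h) (x * h.val) :=
  hx.mul hex (isRightHomogeneous_val h)

lemma IsLeftHomogeneous.mul_val (hex : ∃ N, corFilt k H N = ⊤) {n : ℕ} {g : GroupLike k H}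
    {x : H} (hx : IsLeftHomogeneous n g x) (h : GroupLike k H) :
    IsLeftHomogeneous n (g * h) (x * h.val) :=
  hx.mul hex (isLeftHomogeneous_val h)

lemma IsRightHomogeneous.val_mul (hex : ∃ N, corFilt k H N = ⊤) {n : ℕ} {g : GroupLike k H}
    {x : H} (hx : IsRightHomogeneous n g x) (h : GroupLike k H) :
    IsRightHomogeneous n (h * g) (h.val * x) := by
  simpa using (isRightHomogeneous_val h).mul hex hx

lemma IsLeftHomogeneous.val_mul (hex : ∃ N, corFilt k H N = ⊤) {n : ℕ} {g : GroupLike k H}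
    {x : H} (hx : IsLeftHomogeneous n g x) (h : GroupLike k H) :
    IsLeftHomogeneous n (h * g) (h.val * x) := by
  simpa using (isLeftHomogeneous_val h).mul hex hx

/-- `x` represents a homogeneous element of degree `a` of the infinitesimal braiding: it lies in
degree one of the filtration and has left degree `a` and right degree `1`. -/
structure IsInfinitesimal (a : GroupLike k H) (x : H) : Prop where
  left : IsLeftHomogeneous 1 a x
  right : IsRightHomogeneous 1 (1 : GroupLike k H) x

lemma IsInfinitesimal.actL_mul_sub_mem (hex : ∃ N, corFilt k H N = ⊤) {a b : GroupLike k H}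
    {x y : H} (hx : IsInfinitesimal a x) (hy : IsInfinitesimal b y) {w : H →ₗ[k] k}
    (hw : w ∈ corAnn k H 1) :
    actL w (x * y) - (w x • (a.val * y) + w y • (x * b.val)) ∈ corFilt k H 1 := by
  have := actL_mul_sub_mem_corFilt (q := 0) hex le_rfl hw (fun i j _ _ _ => by omega) hx.right
    (by simpa using hy.right)
  rwa [actL_eq_of_isLeftHomogeneous hx.left hw, actL_eq_of_isLeftHomogeneous hy.left hw,
    smul_mul_assoc, mul_smul_comm] at this

omit [FiniteDimensional k H] in
-- A form supported on left degrees selected by `e` does not see a class whose degree `e` kills.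
lemma IsInfinitesimal.apply_eq_zero {a : GroupLike k H} {x : H}
    (hx : IsInfinitesimal a x) {w : H →ₗ[k] k} (hw : w ∈ corAnn k H 1) {e : H →ₗ[k] k}
    (hwe : w ∘ₗ actR e = w) (he : e a.val = 0) : w x = 0 := by
  have := hw _ (hx.left.actR_sub e)
  rw [he, zero_smul, sub_zero] at this
  rw [← hwe]
  exact this

namespace IsUniversalRForm

lemma apply_mul_groupLike (hr : IsUniversalRForm r) (hex : ∃ N, corFilt k H N = ⊤)
    {a : GroupLike k H} {x : H} (hx : IsInfinitesimal a x) (g : GroupLike k H) {w : H →ₗ[k] k}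
    (hw : w ∈ corAnn k H 1) : w (x * g.val) = r (g.val ⊗ₜ[k] a.val) * w (g.val * x) := by
  have := hw _ (hr.mul_groupLike_sub_mem hex g hx.left hx.right)
  rwa [map_sub, map_smul, smul_eq_mul, sub_eq_zero] at this

/-- Apply w and then v to xy: the derivation rule gives w(x) v(ay) + w(y) v(xb), and b is moved past
x at the cost of r(b,a). -/
lemma add_eq_zero_of_mul_mem (hr : IsUniversalRForm r) (hex : ∃ N, corFilt k H N = ⊤)
    {a b : GroupLike k H} {x y : H} (hx : IsInfinitesimal a x) (hy : IsInfinitesimal b y)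
    (hxy : x * y ∈ corFilt k H 2) {v w : H →ₗ[k] k} (hv : v ∈ corAnn k H 1)
    (hw : w ∈ corAnn k H 1) :
    w x * v (a.val * y) + w y * (r (b.val ⊗ₜ[k] a.val) * v (b.val * x)) = 0 := by
  have h1 : actL w (x * y) ∈ corFilt k H 1 := actL_mem_corFilt_of_mem_corAnn hw hxy
  have h2 := hv _ (sub_mem h1 (hx.actL_mul_sub_mem hex hy hw))
  rwa [sub_sub_cancel, map_add, map_smul, map_smul, hr.apply_mul_groupLike hex hx b hv,
    smul_eq_mul, smul_eq_mul] at h2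

lemma mul_sub_smul_mul_mem (hr : IsUniversalRForm r) (hex : ∃ N, corFilt k H N = ⊤)
    {a b : GroupLike k H} {x y : H} (hx : IsInfinitesimal a x) (hy : IsInfinitesimal b y) :
    y * x - r (a.val ⊗ₜ[k] b.val) • (x * y) ∈ corFilt k H 2 := by
  have := hr.smul_mul_sub_smul_mul_mem hex hx.left hx.right hy.left hy.right
  rwa [hr.apply_one_left, one_smul] at this

variable [CharZero k]

/-- The value 1 is excluded by the powers argument. Otherwise x² ≡ r(a,a) x² forces x² into F_2, and
differentiating twice leaves the factor 1 + r(a,a). -/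
lemma selfBraiding_eq_neg_one (hr : IsUniversalRForm r) (hex : ∃ N, corFilt k H N = ⊤)
    {a : GroupLike k H} {x : H} (hx : IsInfinitesimal a x) (hx1 : x ∉ corFilt k H 1) :
    r (a.val ⊗ₜ[k] a.val) = -1 := by
  obtain ⟨w, hw, hwx⟩ := exists_mem_corAnn_ne_zero hx1
  by_cases h1 : r (a.val ⊗ₜ[k] a.val) = 1
  · exact absurd (hr.apply_eq_zero_of_selfBraiding_eq_one hex le_rfl hx.left hx.right h1 hw
      (fun i j _ _ _ => by omega)) hwx
  · have h2 := hr.mul_sub_smul_mul_mem hex hx hx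
    nth_rw 1 [← one_smul k (x * x)] at h2
    rw [← sub_smul, Submodule.smul_mem_iff _ (sub_ne_zero.2 (Ne.symm h1))] at h2
    obtain ⟨v, hv, hvx⟩ := exists_mem_corAnn_ne_zero
      (mt (groupLike_mul_mem_corFilt_iff hex a).1 hx1)
    have h3 := hr.add_eq_zero_of_mul_mem hex hx hx h2 hv hw
    have h4 : (w x * v (a.val * x)) * (1 + r (a.val ⊗ₜ[k] a.val)) = 0 := by
      rw [← h3]; ring
    exact (neg_eq_of_add_eq_zero_right
      ((mul_eq_zero.1 h4).resolve_left (mul_ne_zero hwx hvx))).symm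

variable [Fintype (GroupLike k H)] [DecidableEq (GroupLike k H)] {e : GroupLike k H → H →ₗ[k] k}

/-- Commuting x and y twice gives (1 - r(a,b) r(b,a)) xy ≡ 0. Were the factor nonzero, then xy would
lie in F_2 and a ≠ b; a form restricted to left degree a differentiates x but not y and contradicts
this. -/
lemma braiding_mul_braiding_eq_one (hr : IsUniversalRForm r) (hex : ∃ N, corFilt k H N = ⊤)
    (he : IsDualIdempotents e) {a b : GroupLike k H} {x y : H} (hx : IsInfinitesimal a x)
    (hy : IsInfinitesimal b y) (hx1 : x ∉ corFilt k H 1) (hy1 : y ∉ corFilt k H 1) :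
    r (a.val ⊗ₜ[k] b.val) * r (b.val ⊗ₜ[k] a.val) = 1 := by
  by_contra hne
  have hab : a ≠ b := by
    rintro rfl
    rw [hr.selfBraiding_eq_neg_one hex hx hx1] at hne
    simp at hne
  have hxy : x * y ∈ corFilt k H 2 := by
    have h1 := add_mem (hr.mul_sub_smul_mul_mem hex hy hx)
      (Submodule.smul_mem _ (r (b.val ⊗ₜ[k] a.val)) (hr.mul_sub_smul_mul_mem hex hx hy))
    have h2 : (1 - r (a.val ⊗ₜ[k] b.val) * r (b.val ⊗ₜ[k] a.val)) • (x * y) ∈ corFilt k H 2 := by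
      convert h1 using 1
      module
    exact (Submodule.smul_mem_iff _ (sub_ne_zero.2 (Ne.symm hne))).1 h2
  obtain ⟨w, hw, hwx⟩ := exists_mem_corAnn_ne_zero hx1
  obtain ⟨v, hv, hvy⟩ := exists_mem_corAnn_ne_zero
    (mt (groupLike_mul_mem_corFilt_iff hex a).1 hy1)
  have hw' : w ∘ₗ actR (e a) ∈ corAnn k H 1 := fun z hz => hw _ (actR_mem_corFilt _ hz)
  have h1 := hw _ (hx.left.actR_sub (e a))
  have h2 := hw _ (hy.left.actR_sub (e a))
  rw [he.apply_val, map_sub, map_smul, sub_eq_zero] at h1 h2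
  rw [if_pos rfl, one_smul] at h1
  rw [if_neg hab, zero_smul] at h2
  have h3 := hr.add_eq_zero_of_mul_mem hex hx hy hxy hv hw'
  rw [LinearMap.comp_apply, LinearMap.comp_apply, h1, h2, zero_mul, add_zero] at h3
  exact mul_ne_zero hwx hvy h3

variable (k H) in
/-- The span of the products of two homogeneous elements of degree one and right degree `1`. -/
noncomputable def infinitesimalProducts : Submodule k H :=
  corFilt k H 2 ⊔ Submodule.span k
    {z | ∃ (a b : GroupLike k H) (x y : H), IsInfinitesimal a x ∧ IsInfinitesimal b y ∧ z = x * y}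

-- Split x and y into bihomogeneous parts of right degrees c' and d'. Only c'd' = 1 contributes
-- modulo F_2, and then xy = (x c'⁻¹)(c' y) has both factors of right degree 1.
omit [CharZero k] in
lemma actL_one_mul_mem_infinitesimalProducts (hex : ∃ N, corFilt k H N = ⊤)
    (he : IsDualIdempotents e) {x y : H} (hx : x ∈ corFilt k H 2) (hy : y ∈ corFilt k H 2) :
    actL (e 1) (x * y) ∈ infinitesimalProducts k H := by
  have key : ∀ (c c' d d' : GroupLike k H) (x y : H), IsLeftHomogeneous 1 c x →
      IsRightHomogeneous 1 c' x → IsLeftHomogeneous 1 d y → IsRightHomogeneous 1 d' y →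
      actL (e 1) (x * y) ∈ infinitesimalProducts k H := by
    intro c c' d d' x y hc hc' hd hd'
    have h1 := (hc'.mul hex hd').actL_sub (e 1)
    rw [he.apply_val] at h1
    rw [← sub_add_cancel (actL (e 1) (x * y)) ((if 1 = c' * d' then (1 : k) else 0) • (x * y))]
    refine add_mem (Submodule.mem_sup_left h1) ?_
    split_ifs with h
    · rw [one_smul]
      refine Submodule.mem_sup_right (Submodule.subset_span
        ⟨c * c'⁻¹, c' * d, x * c'⁻¹.val, c'.val * y, ⟨hc.mul_val hex _, ?_⟩,
          ⟨hd.val_mul hex _, ?_⟩, ?_⟩)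
      · simpa using hc'.mul_val hex c'⁻¹
      · simpa [h] using hd'.val_mul hex c'
      · rw [mul_assoc, ← mul_assoc _ _ y, ← GroupLike.val_mul, inv_mul_cancel, GroupLike.val_one,
          one_mul]
    · rw [zero_smul]
      exact zero_mem _
  rw [← he.sum_actL x, ← he.sum_actL y]
  simp only [Finset.sum_mul, Finset.mul_sum, map_sum]
  refine Submodule.sum_mem _ fun d' _ => Submodule.sum_mem _ fun c' _ => ?_
  rw [← he.sum_actR (actL (e c') x), ← he.sum_actR (actL (e d') y)]
  simp only [Finset.sum_mul, Finset.mul_sum, map_sum]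
  refine Submodule.sum_mem _ fun d _ => Submodule.sum_mem _ fun c _ => ?_
  exact key c _ d _ _ _ (he.isLeftHomogeneous _ (actL_mem_corFilt _ hx))
    ((he.isRightHomogeneous _ hx).actR (i := 0) (mem_corAnn_zero _))
    (he.isLeftHomogeneous _ (actL_mem_corFilt _ hy))
    ((he.isRightHomogeneous _ hy).actR (i := 0) (mem_corAnn_zero _))

/-- The degree of an element which is not in the second term of the filtration is a product of
two degrees of the infinitesimal braiding. -/
lemma selfBraiding_eq_one_of_degree_two (hr : IsUniversalRForm r) (hex : ∃ N, corFilt k H N = ⊤)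
    (he : IsDualIdempotents e) {g : GroupLike k H} {z : H} (hz : IsLeftHomogeneous 2 g z)
    (hz' : IsRightHomogeneous 2 (1 : GroupLike k H) z) (hz2 : z ∉ corFilt k H 2) :
    r (g.val ⊗ₜ[k] g.val) = 1 := by
  rw [mem_corFilt_succ] at hz2
  push Not at hz2
  obtain ⟨f, hf, hfz⟩ := hz2
  rw [← corAnn_one] at hf
  obtain ⟨b, hb⟩ : ∃ b, actL (e b) (actL f z) ∉ corFilt k H 1 := by
    by_contra! h
    exact hfz (he.sum_actL (actL f z) ▸ Submodule.sum_mem _ fun b _ => h b)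
  obtain ⟨f', hf', hf'z⟩ := exists_mem_corAnn_ne_zero hb
  -- The two tensor factors of the (1,1)-part of Δ(z), with middle degree b, supply classes of
  -- degrees gb⁻¹ and b, both nonzero modulo F_1.
  have hx : IsInfinitesimal (g * b⁻¹) (actL (e b) (actL f z) * b⁻¹.val) := by
    refine ⟨IsLeftHomogeneous.mul_val hex ?_ _, ?_⟩
    · exact IsLeftHomogeneous.actL (i := 0) (hz.actL (i := 1) (n := 1) hf) (mem_corAnn_zero _)
    · have := (he.isRightHomogeneous b
        (actL_mem_corFilt_of_mem_corAnn (n := 2) hf hz.mem)).mul_val hex b⁻¹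
      rwa [mul_inv_cancel] at this
  have hy' := hz'.actR (i := 1) (n := 1) hf'
  have hy : IsInfinitesimal b (actR (e b) (actR f' z)) :=
    ⟨he.isLeftHomogeneous b hy'.mem, hy'.actR (i := 0) (mem_corAnn_zero _)⟩
  have hx1 : actL (e b) (actL f z) * b⁻¹.val ∉ corFilt k H 1 :=
    mt (mul_groupLike_mem_corFilt_iff hex _).1 hb
  have hy1 : actR (e b) (actR f' z) ∉ corFilt k H 1 := by
    intro h
    apply hf'z
    rw [actL_actL, apply_actL, LinearMap.comp_apply, apply_actL]
    exact hf _ h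
  have h1 := hr.selfBraiding_eq_neg_one hex hx hx1
  have h2 := hr.selfBraiding_eq_neg_one hex hy hy1
  have h3 := hr.braiding_mul_braiding_eq_one hex he hx hy hx1 hy1
  obtain ⟨a, rfl⟩ : ∃ a, g = a * b := ⟨g * b⁻¹, by simp⟩
  rw [mul_inv_cancel_right] at h1 h3
  rw [hr.apply_mul_left, hr.apply_mul_right, hr.apply_mul_right, h1, h2]
  linear_combination h3

/-- In degree two, there are no indecomposable elements. -/
lemma mem_infinitesimalProducts (hr : IsUniversalRForm r) (hex : ∃ N, corFilt k H N = ⊤)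
    (he : IsDualIdempotents e) {v : H} (hv : IsRightHomogeneous 2 (1 : GroupLike k H) v) :
    v ∈ infinitesimalProducts k H := by
  by_contra hnv
  obtain ⟨g, hg⟩ : ∃ g, actR (e g) v ∉ infinitesimalProducts k H := by
    by_contra! h
    exact hnv (he.sum_actR v ▸ Submodule.sum_mem _ fun g _ => h g)
  have hz := he.isLeftHomogeneous g hv.mem
  have hz' : IsRightHomogeneous 2 (1 : GroupLike k H) (actR (e g) v) :=
    hv.actR (i := 0) (mem_corAnn_zero _)
  have hrg := hr.selfBraiding_eq_one_of_degree_two hex he hz hz'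
    fun h => hg (Submodule.mem_sup_left h)
  obtain ⟨w, hwz, hw⟩ := Submodule.exists_le_ker_of_notMem hg
  have hw2 : ∀ x ∈ corFilt k H 2, w x = 0 := fun x hx => hw (Submodule.mem_sup_left hx)
  -- By itself w kills only products of factors of right degree 1. Composing with the projection
  -- `actL (e 1)` makes it kill all decomposables without changing its value at the chosen element.
  have h1 := hr.apply_eq_zero_of_selfBraiding_eq_one hex (by norm_num) hz hz' hrg
    (w := w ∘ₗ actL (e 1)) (fun x hx => hw2 _ (actL_mem_corFilt _ hx)) (by
      intro i j hi hj hij x hx y hy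
      obtain rfl : i = 1 := by omega
      obtain rfl : j = 1 := by omega
      exact hw (actL_one_mul_mem_infinitesimalProducts hex he hx hy))
  have h2 := hw2 _ (hz'.actL_sub (e 1))
  rw [he.apply_val, if_pos rfl, one_smul, map_sub, sub_eq_zero] at h2
  exact hwz (h2.symm.trans h1)

end IsUniversalRForm

end LowDegree

/-! ### The Euler operator. -/

section Euler

open Coalgebra

variable {k : Type u} {H : Type v} [Field k] [Ring H] [HopfAlgebra k H] {r : H ⊗[k] H →ₗ[k] k}
  [FiniteDimensional k H] [Fintype (GroupLike k H)] [DecidableEq (GroupLike k H)]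
  {e : GroupLike k H → H →ₗ[k] k}

/-- Homogeneous elements `x s` spanning the infinitesimal braiding, with dual linear forms `ξ s`. -/
structure IsInfinitesimalFrame (e : GroupLike k H → H →ₗ[k] k) {σ : Type*} [Fintype σ]
    (ξ : σ → H →ₗ[k] k) (x : σ → H) (a : σ → GroupLike k H) : Prop where
  mem_corAnn : ∀ s, ξ s ∈ corAnn k H 1
  comp_actR : ∀ s, ξ s ∘ₗ actR (e (a s)) = ξ s
  isInfinitesimal : ∀ s, IsInfinitesimal (a s) (x s)
  sub_sum_mem : ∀ v, IsRightHomogeneous 1 (1 : GroupLike k H) v →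
    v - ∑ s, ξ s v • x s ∈ corFilt k H 1

omit [FiniteDimensional k H] in
lemma IsDualIdempotents.actR_actR_self (he : IsDualIdempotents e) (a : GroupLike k H) (x : H) :
    actR (e a) (actR (e a) x) = actR (e a) x := by
  rw [actR_actR, he.comp_actL, if_pos rfl]

lemma exists_isInfinitesimalFrame (hex : ∃ N, corFilt k H N = ⊤) (he : IsDualIdempotents e) :
    ∃ (σ : Type v) (_ : Fintype σ) (ξ : σ → H →ₗ[k] k) (x : σ → H) (a : σ → GroupLike k H),
      IsInfinitesimalFrame e ξ x a := by
  obtain ⟨N, hN⟩ := id hex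
  obtain ⟨ι, _, b, β, d, hfr⟩ := exists_isFilteredFrame hN
  refine ⟨{i // d i = 1} × GroupLike k H, inferInstance, fun s => β s.1 ∘ₗ actR (e s.2),
    fun s => actL (e 1) (actR (e s.2) (b s.1)), fun s => s.2, ?_, ?_, ?_, ?_⟩
  · intro s z hz
    have := hfr.mem_corAnn s.1
    rw [s.1.2] at this
    exact this _ (actR_mem_corFilt _ hz)
  · intro s
    ext z
    simp [he.actR_actR_self]
  · intro s
    have hb : b s.1 ∈ corFilt k H 2 := by
      have := hfr.mem_corFilt s.1
      rwa [s.1.2] at this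
    exact ⟨(he.isLeftHomogeneous s.2 hb).actL (i := 0) (mem_corAnn_zero _),
      he.isRightHomogeneous 1 (actR_mem_corFilt _ hb)⟩
  · intro v hv
    -- On F_2 modulo F_1 only frame members of degree one matter: those of degree 0 lie in F_1, and
    -- forms of higher degree vanish on F_2.
    have h1 : ∀ u ∈ corFilt k H 2, u - ∑ i : {i // d i = 1}, β i u • b i ∈ corFilt k H 1 := by
      intro u hu
      have h2 : ∑ i : {i // d i = 1}, β i u • b i = ∑ i, if d i = 1 then β i u • b i else 0 := by
        rw [← Finset.sum_filter]
        exact (Finset.sum_subtype _ (by simp) fun i => β i u • b i).symm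
      have h3 : u - ∑ i, (if d i = 1 then β i u • b i else 0) =
          ∑ i, if d i = 1 then 0 else β i u • b i := by
        conv_lhs => enter [1]; rw [← hfr.sum_smul u]
        rw [← Finset.sum_sub_distrib]
        exact Finset.sum_congr rfl fun i _ => by split_ifs <;> simp
      rw [h2, h3]
      refine Submodule.sum_mem _ fun i _ => ?_
      split_ifs with hi
      · exact zero_mem _
      rcases Nat.eq_zero_or_pos (d i) with h0 | h0
      · have := hfr.mem_corFilt i
        rw [h0] at this
        exact Submodule.smul_mem _ _ this
      · rw [hfr.mem_corAnn i u (corFilt_mono (by omega) hu), zero_smul]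
        exact zero_mem _
    have h2 : ∀ a, actR (e a) v - ∑ i : {i // d i = 1}, β i (actR (e a) v) •
        actL (e 1) (actR (e a) (b i)) ∈ corFilt k H 1 := by
      intro a
      have h3 := actL_mem_corFilt (e 1) (actR_mem_corFilt (e a)
        (h1 _ (actR_mem_corFilt (e a) hv.mem)))
      simp only [map_sub, map_sum, map_smul, he.actR_actR_self] at h3
      have h4 := (hv.actR (i := 0) (mem_corAnn_zero (e a))).actL_sub (e 1)
      rw [he.apply_val, if_pos rfl, one_smul] at h4
      have := sub_mem h3 h4
      convert this using 1
      abel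
    rw [Fintype.sum_prod_type_right]
    have h3 := Submodule.sum_mem _ fun a (_ : a ∈ Finset.univ) => h2 a
    rwa [Finset.sum_sub_distrib, he.sum_actR] at h3

/-- The Euler operator attached to an infinitesimal frame. -/
noncomputable def eulerOp {σ : Type*} [Fintype σ] (ξ : σ → H →ₗ[k] k) (x : σ → H)
    (a : σ → GroupLike k H) : H →ₗ[k] H :=
  ∑ s, LinearMap.mulRight k ((a s)⁻¹.val * x s) ∘ₗ actL (ξ s)

omit [FiniteDimensional k H] [Fintype (GroupLike k H)] [DecidableEq (GroupLike k H)] in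
lemma eulerOp_apply {σ : Type*} [Fintype σ] (ξ : σ → H →ₗ[k] k) (x : σ → H)
    (a : σ → GroupLike k H) (z : H) :
    eulerOp ξ x a z = ∑ s, actL (ξ s) z * ((a s)⁻¹.val * x s) := by
  simp only [eulerOp, LinearMap.sum_apply, LinearMap.comp_apply, LinearMap.mulRight_apply]

omit [FiniteDimensional k H] [Fintype (GroupLike k H)] [DecidableEq (GroupLike k H)] in
-- Duality: φ(actL θ z) = θ(actR φ z), and `actR φ z` has degree j when φ kills F_m. Thus an
-- operator identity of order j need only be tested in degree j.
lemma actL_mem_corFilt_of_forall {m j : ℕ} {h : GroupLike k H} {θ : H →ₗ[k] k}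
    (hθ : ∀ v, IsRightHomogeneous j h v → θ v = 0) {z : H}
    (hz : IsRightHomogeneous (j + m) h z) : actL θ z ∈ corFilt k H m := by
  refine mem_corFilt_of_forall fun φ hφ => ?_
  rw [apply_actL]
  exact hθ _ (hz.actR hφ)

namespace IsUniversalRForm

lemma apply_actL_mul_groupLike_inv (hr : IsUniversalRForm r) (hex : ∃ N, corFilt k H N = ⊤)
    (he : IsDualIdempotents e) {a c d : GroupLike k H} {ξ ψ : H →ₗ[k] k} (hξ : ξ ∈ corAnn k H 1)
    (hξa : ξ ∘ₗ actR (e a) = ξ) (hψ : ψ ∈ corAnn k H 1) {x y : H} (hx : IsInfinitesimal c x)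
    (hy : IsInfinitesimal d y) :
    ψ (actL ξ (x * y) * a⁻¹.val) =
      r (a⁻¹.val ⊗ₜ[k] d.val) * (ξ x * ψ y) + ξ y * ψ x := by
  have h1 := hψ _ (mul_groupLike_mem_corFilt hex a⁻¹ (hx.actL_mul_sub_mem hex hy hξ))
  rw [sub_mul, map_sub, sub_eq_zero, add_mul, map_add, smul_mul_assoc, smul_mul_assoc, map_smul,
    map_smul, smul_eq_mul, smul_eq_mul] at h1
  rw [h1]
  congr 1
  · by_cases hca : c = a
    · subst hca
      have h2 := hψ _ (groupLike_mul_mem_corFilt hex c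
        (hr.mul_groupLike_sub_mem hex c⁻¹ hy.left hy.right))
      rw [mul_sub, mul_smul_comm, ← mul_assoc, ← mul_assoc, ← GroupLike.val_mul, mul_inv_cancel,
        GroupLike.val_one, one_mul, map_sub, map_smul, sub_eq_zero, smul_eq_mul] at h2
      rw [h2]
      ring
    · rw [hx.apply_eq_zero hξ hξa (by rw [he.apply_val, if_neg (Ne.symm hca)])]
      ring
  · by_cases hda : d = a
    · subst hda
      rw [mul_assoc, ← GroupLike.val_mul, mul_inv_cancel, GroupLike.val_one, mul_one]
    · rw [hy.apply_eq_zero hξ hξa (by rw [he.apply_val, if_neg (Ne.symm hda)])]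
      ring

variable [CharZero k]

/-- The difference is `actL θ z * a⁻¹` for a single form θ of order two, so θ need only vanish on
classes of degree two and right degree 1. These are sums of products modulo F_2, where the explicit
second derivatives agree because r(a,b) r(b,a) = 1. -/
lemma actL_comm_mem (hr : IsUniversalRForm r) (hex : ∃ N, corFilt k H N = ⊤)
    (he : IsDualIdempotents e) {n : ℕ} {a b : GroupLike k H} {ξ ψ : H →ₗ[k] k}
    (hξ : ξ ∈ corAnn k H 1) (hξa : ξ ∘ₗ actR (e a) = ξ) (hψ : ψ ∈ corAnn k H 1)
    (hψb : ψ ∘ₗ actR (e b) = ψ) {z : H} (hz : IsRightHomogeneous (2 + n) (1 : GroupLike k H) z) :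
    actL ψ (actL ξ z * a⁻¹.val) -
      r (b.val ⊗ₜ[k] a.val) • (actL ξ (actL ψ z * b⁻¹.val) * (a⁻¹ * b).val) ∈ corFilt k H n := by
  let θ : H →ₗ[k] k := (ψ ∘ₗ LinearMap.mulRight k a⁻¹.val) ∘ₗ actL ξ -
    r (b.val ⊗ₜ[k] a.val) • (ξ ∘ₗ LinearMap.mulRight k b⁻¹.val) ∘ₗ actL ψ
  have hθz : actL ψ (actL ξ z * a⁻¹.val) -
      r (b.val ⊗ₜ[k] a.val) • (actL ξ (actL ψ z * b⁻¹.val) * (a⁻¹ * b).val) =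
      actL θ z * a⁻¹.val := by
    rw [actL_mul_groupLike, actL_mul_groupLike, actL_actL, actL_actL, mul_assoc _ b⁻¹.val,
      ← GroupLike.val_mul, hr.groupLike_mul_comm hex a⁻¹ b, inv_mul_cancel_left]
    simp only [θ, map_sub, map_smul, LinearMap.sub_apply, LinearMap.smul_apply, sub_mul,
      smul_mul_assoc]
  rw [hθz]
  refine mul_groupLike_mem_corFilt hex _ (actL_mem_corFilt_of_forall (fun v hv => ?_) hz)
  have hθ : ∀ u, θ u = ψ (actL ξ u * a⁻¹.val) -
      r (b.val ⊗ₜ[k] a.val) * ξ (actL ψ u * b⁻¹.val) := fun u => rfl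
  have hker : infinitesimalProducts k H ≤ LinearMap.ker θ := by
    refine sup_le (fun u hu => ?_) (Submodule.span_le.2 ?_)
    · rw [LinearMap.mem_ker, hθ,
        hψ _ (mul_groupLike_mem_corFilt hex _ (actL_mem_corFilt_of_mem_corAnn hξ hu)),
        hξ _ (mul_groupLike_mem_corFilt hex _ (actL_mem_corFilt_of_mem_corAnn hψ hu))]
      simp
    · rintro _ ⟨c, d, x, y, hx, hy, rfl⟩
      rw [SetLike.mem_coe, LinearMap.mem_ker, hθ,
        hr.apply_actL_mul_groupLike_inv hex he hξ hξa hψ hx hy,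
        hr.apply_actL_mul_groupLike_inv hex he hψ hψb hξ hx hy]
      have h1 : r (a⁻¹.val ⊗ₜ[k] d.val) * (ξ x * ψ y) = r (b.val ⊗ₜ[k] a.val) * (ξ x * ψ y) := by
        by_cases hξx : ξ x = 0
        · simp [hξx]
        by_cases hψy : ψ y = 0
        · simp [hψy]
        obtain rfl : c = a := by
          by_contra hne
          exact hξx (hx.apply_eq_zero hξ hξa (by rw [he.apply_val, if_neg (Ne.symm hne)]))
        obtain rfl : d = b := by
          by_contra hne
          exact hψy (hy.apply_eq_zero hψ hψb (by rw [he.apply_val, if_neg (Ne.symm hne)]))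
        have h2 := hr.braiding_mul_braiding_eq_one hex he hx hy (fun h => hξx (hξ _ h))
          fun h => hψy (hψ _ h)
        have h3 := hr.apply_inv_left c d
        congr 1
        exact mul_right_cancel₀ (hr.apply_ne_zero c d) (h3.trans (by rw [mul_comm, h2]))
      have h2 : r (b.val ⊗ₜ[k] a.val) * (r (b⁻¹.val ⊗ₜ[k] d.val) * (ψ x * ξ y)) = ψ x * ξ y := by
        by_cases hξy : ξ y = 0
        · simp [hξy]
        obtain rfl : d = a := by
          by_contra hne
          exact hξy (hy.apply_eq_zero hξ hξa (by rw [he.apply_val, if_neg (Ne.symm hne)]))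
        rw [← mul_assoc, mul_comm (r (b.val ⊗ₜ[k] d.val)), hr.apply_inv_left, one_mul]
      linear_combination h1 - h2
  exact hker (hr.mem_infinitesimalProducts hex he hv)

/-- The Euler operator multiplies homogeneous elements of degree `n` by `n`. -/
lemma eulerOp_sub_mem (hr : IsUniversalRForm r) (hex : ∃ N, corFilt k H N = ⊤)
    (he : IsDualIdempotents e) {σ : Type*} [Fintype σ] {ξ : σ → H →ₗ[k] k} {x : σ → H}
    {a : σ → GroupLike k H} (hfr : IsInfinitesimalFrame e ξ x a) (n : ℕ) {z : H}
    (hz : IsRightHomogeneous (n + 1) (1 : GroupLike k H) z) :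
    eulerOp ξ x a z - (n + 1 : k) • z ∈ corFilt k H (n + 1) := by
  induction n generalizing z with
  | zero =>
    -- In left degree g, the form ξ_s gives ξ_s(z) g, which is zero unless g = a_s and is then
    -- cancelled by a_s⁻¹. The operator reproduces the frame expansion.
    have key : ∀ g, eulerOp ξ x a (actR (e g) z) - actR (e g) z ∈ corFilt k H 1 := by
      intro g
      have hg : IsInfinitesimal g (actR (e g) z) :=
        ⟨he.isLeftHomogeneous g hz.mem, IsRightHomogeneous.actR (i := 0) hz (mem_corAnn_zero _)⟩
      have h1 : eulerOp ξ x a (actR (e g) z) = ∑ s, ξ s (actR (e g) z) • x s := by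
        rw [eulerOp_apply]
        refine Finset.sum_congr rfl fun s _ => ?_
        rw [actL_eq_of_isLeftHomogeneous hg.left (hfr.mem_corAnn s), smul_mul_assoc]
        by_cases hs : g = a s
        · rw [← mul_assoc, ← GroupLike.val_mul, ← hs, mul_inv_cancel, GroupLike.val_one, one_mul]
        · rw [hg.apply_eq_zero (hfr.mem_corAnn s) (hfr.comp_actR s)
            (by rw [he.apply_val, if_neg (Ne.symm hs)]), zero_smul, zero_smul]
      rw [h1, ← neg_sub]
      exact neg_mem (hfr.sub_sum_mem _ hg.right)
    have h2 : eulerOp ξ x a z - z = ∑ g, (eulerOp ξ x a (actR (e g) z) - actR (e g) z) := by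
      rw [Finset.sum_sub_distrib, ← map_sum, he.sum_actR]
    simpa [h2] using Submodule.sum_mem _ fun g _ => key g
  | succ n ih =>
    -- Membership in F_(n+2) is tested by J, and forms supported in one left degree suffice.
    have main : ∀ (b : GroupLike k H) (ψ : H →ₗ[k] k), ψ ∈ corAnn k H 1 →
        ψ ∘ₗ actR (e b) = ψ → actL ψ (eulerOp ξ x a z - ((n + 1 : ℕ) + 1 : k) • z) ∈
          corFilt k H (n + 1) := by
      intro b ψ hψ hψb
      have hright : ∀ (c : GroupLike k H) (φ : H →ₗ[k] k), φ ∈ corAnn k H 1 →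
          φ ∘ₗ actR (e c) = φ →
          IsRightHomogeneous (n + 1) (1 : GroupLike k H) (actL φ z * c⁻¹.val) := by
        intro c φ hφ hφc
        have h1 : actL φ z = actL (e c) (actL φ z) := by
          rw [actL_actL]
          congr 2
          conv_lhs => rw [← hφc]
          ext u
          simp [apply_actR]
        have h2 := (he.isRightHomogeneous c
          (actL_mem_corFilt_of_mem_corAnn (n := n + 2) hφ hz.mem)).mul_val hex c⁻¹
        rwa [← h1, mul_inv_cancel] at h2
      -- The derivation rule splits each summand. The second parts add up to `actL ψ z` by `h2`,
      -- which accounts for the extra 1 in the eigenvalue.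
      have h1 : ∀ s, actL ψ (actL (ξ s) z * ((a s)⁻¹.val * x s)) -
          (actL ψ (actL (ξ s) z * (a s)⁻¹.val) * x s + ψ (x s) • actL (ξ s) z) ∈
          corFilt k H (n + 1) := by
        intro s
        have := actL_mul_sub_mem_corFilt (q := 0) hex le_rfl hψ (fun i j _ _ _ => by omega)
          (hright (a s) (ξ s) (hfr.mem_corAnn s) (hfr.comp_actR s))
          (by simpa using (hfr.isInfinitesimal s).right)
        rwa [actL_eq_of_isLeftHomogeneous (hfr.isInfinitesimal s).left hψ, mul_smul_comm,
          mul_assoc _ _ (a s).val, ← GroupLike.val_mul, inv_mul_cancel, GroupLike.val_one,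
          mul_one, mul_assoc] at this
      have h2 : ∑ s, ψ (x s) • actL (ξ s) z - actL ψ z ∈ corFilt k H (n + 1) := by
        have : ∑ s, ψ (x s) • actL (ξ s) z - actL ψ z = actL (∑ s, ψ (x s) • ξ s - ψ) z := by
          simp
        rw [this]
        refine actL_mem_corFilt_of_forall (j := 1) (h := 1) (fun v hv => ?_)
          (by rwa [add_comm 1])
        have h3 := hψ _ (hfr.sub_sum_mem v hv)
        rw [map_sub, map_sum, sub_eq_zero] at h3
        simp [h3, mul_comm]
      -- Induction hypothesis for `actL ψ z * b⁻¹`: commuting ψ past ξ_s and b past x_s produces the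
      -- same scalar r(b, a_s), so the two cancel.
      have h3 : ∑ s, actL ψ (actL (ξ s) z * (a s)⁻¹.val) * x s - (n + 1 : k) • actL ψ z ∈
          corFilt k H (n + 1) := by
        have h4 := mul_groupLike_mem_corFilt hex b (ih (hright b ψ hψ hψb))
        rw [sub_mul, smul_mul_assoc, mul_assoc _ _ b.val, ← GroupLike.val_mul, inv_mul_cancel,
          GroupLike.val_one, mul_one, eulerOp_apply, Finset.sum_mul] at h4
        refine (Submodule.sub_mem_iff_left _ h4).1 ?_
        rw [sub_sub_sub_cancel_right, ← Finset.sum_sub_distrib]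
        refine Submodule.sum_mem _ fun s _ => ?_
        have h5 := mul_mem_corFilt hex (hr.actL_comm_mem hex he (n := n) (hfr.mem_corAnn s)
          (hfr.comp_actR s) hψ hψb (by rwa [add_comm 2])) (hfr.isInfinitesimal s).left.mem
        have h6 : actL (ξ s) (actL ψ z * b⁻¹.val) ∈ corFilt k H (n + 1) :=
          actL_mem_corFilt_of_mem_corAnn (hfr.mem_corAnn s) (hright b ψ hψ hψb).mem
        have h7 := mul_mem_corFilt hex (mul_groupLike_mem_corFilt hex (a s)⁻¹ h6)
          (hr.mul_groupLike_sub_mem hex b (hfr.isInfinitesimal s).left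
            (hfr.isInfinitesimal s).right)
        convert sub_mem h5 h7 using 1
        rw [GroupLike.val_mul, sub_mul, mul_sub, smul_mul_assoc, mul_smul_comm]
        simp only [mul_assoc]
        abel
      have h8 := add_mem (add_mem (Submodule.sum_mem _ fun s (_ : s ∈ Finset.univ) => h1 s) h2) h3
      rw [Finset.sum_sub_distrib, Finset.sum_add_distrib] at h8
      convert h8 using 1
      rw [map_sub, eulerOp_apply, map_sum, map_smul]
      push_cast
      module
    rw [mem_corFilt_succ]
    intro ψ hψ
    have hsum : ψ = ∑ b, ψ ∘ₗ actR (e b) := by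
      ext u
      conv_lhs => rw [← he.sum_actR u]
      simp
    rw [hsum, map_sum, LinearMap.sum_apply]
    refine Submodule.sum_mem _ fun b _ => main b _ ?_ ?_
    · rw [← corAnn_one] at hψ
      exact fun u hu => hψ _ (actR_mem_corFilt _ hu)
    · ext u
      simp [he.actR_actR_self]

end IsUniversalRForm

end Euler

/-! ### Skew-primitives span degree one, and the final induction. -/

section Generation

open Coalgebra

variable {k : Type u} {H : Type v} [Field k] [Ring H] [HopfAlgebra k H] {r : H ⊗[k] H →ₗ[k] k}
  [FiniteDimensional k H]

/-- A homogeneous element in degree one of the filtration is skew-primitive up to a multiple of a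
group-like element. -/
lemma IsDualIdempotents.isSkewPrimitiveElem [Fintype (GroupLike k H)]
    [DecidableEq (GroupLike k H)] {e : GroupLike k H → H →ₗ[k] k}
    (hex : ∃ N, corFilt k H N = ⊤) (he : IsDualIdempotents e) {z : H} (hz : z ∈ corFilt k H 2)
    {g h : GroupLike k H} (hzh : actL (e h) z = z) (hzg : actR (e g) z = z) :
    IsSkewPrimitiveElem k (z - e h z • g.val) := by
  have hleft : IsLeftHomogeneous 1 g z := hzg ▸ he.isLeftHomogeneous g hz
  have hez : ∀ b, actL (e b) z = if b = h then z else 0 := by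
    intro b
    conv_lhs => rw [← hzh, actL_actL, he.comp_actL]
    split_ifs with hb
    · rw [hb, hzh]
    · simp
  have hez' : ∀ b, e b z = if b = h then e h z else 0 := by
    intro b
    rw [← counit_actL (e b), hez]
    split_ifs
    · rw [← counit_actL (e h), hzh]
    · simp
  -- Split f into its group-like part ∑ f(b) e_b, which acts on z through h, and a remainder in J,
  -- which sends z to a multiple of g.
  have hact : ∀ f : H →ₗ[k] k,
      actL f z = f h.val • z + f z • g.val - (f h.val * e h z) • g.val := by
    intro f
    have hf : f - ∑ b : GroupLike k H, f b.val • e b ∈ corAnn k H 1 := by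
      rw [corAnn_one]
      intro c hc
      have : ∀ b, e b c = if b = (⟨c, hc⟩ : GroupLike k H) then 1 else 0 := fun b =>
        he.apply_val b ⟨c, hc⟩
      simp [LinearMap.sum_apply, this]
    have h1 := actL_eq_of_isLeftHomogeneous hleft hf
    have h2 : actL (∑ b : GroupLike k H, f b.val • e b) z = f h.val • z := by
      rw [map_sum, LinearMap.sum_apply, Finset.sum_eq_single h]
      · rw [map_smul, LinearMap.smul_apply, hzh]
      · intro b _ hb
        rw [map_smul, LinearMap.smul_apply, hez, if_neg hb, smul_zero]
      · simp
    have h3 : (∑ b : GroupLike k H, f b.val • e b) z = f h.val * e h z := by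
      rw [LinearMap.sum_apply, Finset.sum_eq_single h]
      · rfl
      · intro b _ hb
        rw [LinearMap.smul_apply, hez', if_neg hb, smul_zero]
      · simp
    rw [map_sub, LinearMap.sub_apply, LinearMap.sub_apply, h2, h3, sub_smul,
      sub_eq_iff_eq_add] at h1
    rw [h1]
    abel
  obtain ⟨N, hN⟩ := hex
  obtain ⟨ι, _, b, β, d, hfr⟩ := exists_isFilteredFrame hN
  refine ⟨h.val, g.val, h.2, g.2, ?_⟩
  -- The extra term has coefficient ε(z) = e_h(z); subtracting that multiple of g removes it.
  have hcomul : comul (R := k) z = z ⊗ₜ[k] h.val + g.val ⊗ₜ[k] z -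
      e h z • (g.val ⊗ₜ[k] h.val) := by
    rw [comul_eq_sum_actL hfr.sum_smul]
    conv_rhs => rw [← hfr.sum_smul h.val]; enter [1, 2]; rw [← hfr.sum_smul z]
    simp only [hact, TensorProduct.sub_tmul, TensorProduct.add_tmul, TensorProduct.tmul_sum,
      TensorProduct.tmul_smul, TensorProduct.smul_tmul', Finset.sum_sub_distrib,
      Finset.sum_add_distrib, Finset.smul_sum, smul_smul, mul_comm]
  rw [map_sub, map_smul, hcomul, g.2.comul_eq_tmul_self, TensorProduct.sub_tmul,
    TensorProduct.tmul_sub, TensorProduct.tmul_smul, TensorProduct.smul_tmul']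
  abel

variable (k H) in
/-- The subalgebra generated by the group-like and the skew-primitive elements. -/
def groupLikeSkewPrimitiveAdjoin : Subalgebra k H :=
  Algebra.adjoin k ({x : H | IsGroupLikeElem k x} ∪ {x : H | IsSkewPrimitiveElem k x})

omit [FiniteDimensional k H] in
lemma val_mem_groupLikeSkewPrimitiveAdjoin (g : GroupLike k H) :
    g.val ∈ groupLikeSkewPrimitiveAdjoin k H :=
  Algebra.subset_adjoin (Or.inl g.2)

lemma corFilt_two_le [Fintype (GroupLike k H)] [DecidableEq (GroupLike k H)]
    {e : GroupLike k H → H →ₗ[k] k} (hex : ∃ N, corFilt k H N = ⊤) (he : IsDualIdempotents e) :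
    corFilt k H 2 ≤ (groupLikeSkewPrimitiveAdjoin k H).toSubmodule := by
  intro z hz
  rw [← he.sum_actL z]
  refine Submodule.sum_mem _ fun h _ => ?_
  rw [← he.sum_actR (actL (e h) z)]
  refine Submodule.sum_mem _ fun g _ => ?_
  rw [← sub_add_cancel (actR (e g) _) (e h (actR (e g) (actL (e h) z)) • g.val)]
  refine add_mem (Algebra.subset_adjoin (Or.inr ?_))
    (Submodule.smul_mem _ _ (val_mem_groupLikeSkewPrimitiveAdjoin g))
  refine he.isSkewPrimitiveElem hex (actR_mem_corFilt _ (actL_mem_corFilt _ hz)) ?_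
    (he.actR_actR_self _ _)
  rw [actL_actR_comm, actL_actL, he.comp_actL, if_pos rfl]

/-- The Euler operator lands in the subalgebra by induction, and differs from a nonzero integer
multiple of the element by a term lower in the filtration. -/
lemma IsUniversalRForm.corFilt_le_groupLikeSkewPrimitiveAdjoin [CharZero k]
    (hr : IsUniversalRForm r) (hex : ∃ N, corFilt k H N = ⊤) (n : ℕ) :
    corFilt k H (n + 2) ≤ (groupLikeSkewPrimitiveAdjoin k H).toSubmodule := by
  classical
  have := Fintype.ofFinite (GroupLike k H)
  obtain ⟨e, he⟩ := exists_isDualIdempotents hex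
  obtain ⟨σ, _, ξ, x, a, hfr⟩ := exists_isInfinitesimalFrame hex he
  have h2 := corFilt_two_le hex he
  induction n with
  | zero => exact h2
  | succ n ih =>
    intro z hz
    rw [← he.sum_actL z]
    refine Submodule.sum_mem _ fun h _ => ?_
    -- Multiplying by h⁻¹ moves the component to right degree 1, where the Euler operator applies; h
    -- is restored at the end.
    have hu := (he.isRightHomogeneous h hz).mul_val hex h⁻¹
    rw [mul_inv_cancel] at hu
    set w := actL (e h) z * h⁻¹.val with hw
    have h3 : eulerOp ξ x a w ∈ groupLikeSkewPrimitiveAdjoin k H := by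
      rw [eulerOp_apply]
      exact sum_mem fun s _ => mul_mem
        (ih (actL_mem_corFilt_of_mem_corAnn (hfr.mem_corAnn s) hu.mem))
        (mul_mem (val_mem_groupLikeSkewPrimitiveAdjoin _) (h2 (hfr.isInfinitesimal s).left.mem))
    have h4 := ih (hr.eulerOp_sub_mem hex he hfr (n + 1) hu)
    have h5 : ((n + 1 : ℕ) + 1 : k) • w ∈ (groupLikeSkewPrimitiveAdjoin k H).toSubmodule := by
      have := sub_mem (show _ ∈ (groupLikeSkewPrimitiveAdjoin k H).toSubmodule from h3) h4
      rwa [sub_sub_cancel] at this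
    have h6 : w ∈ groupLikeSkewPrimitiveAdjoin k H :=
      (Submodule.smul_mem_iff _ (Nat.cast_add_one_ne_zero (n + 1))).1 h5
    have h7 := mul_mem h6 (val_mem_groupLikeSkewPrimitiveAdjoin h)
    rwa [hw, mul_assoc, ← GroupLike.val_mul, inv_mul_cancel, GroupLike.val_one, mul_one] at h7

end Generation

theorem proposition6p1 {k : Type u} {H : Type v} [Field k] [IsAlgClosed k] [CharZero k]
    [Ring H] [HopfAlgebra k H] [FiniteDimensional k H]
    (hpointed : IsPointedCoalgebra k H)
    (hcoquasi : ∃ r : H ⊗[k] H →ₗ[k] k, IsUniversalRForm r) :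
    Algebra.adjoin k ({x : H | IsGroupLikeElem k x} ∪ {x : H | IsSkewPrimitiveElem k x}) = ⊤ := by
  obtain ⟨r, hr⟩ := hcoquasi
  have hex := exists_corFilt_eq_top hpointed
  obtain ⟨N, hN⟩ := id hex
  rw [eq_top_iff]
  intro x _
  refine hr.corFilt_le_groupLikeSkewPrimitiveAdjoin hex N (corFilt_mono (Nat.le_add_right N 2) ?_)
  rw [hN]
  trivial
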